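/- Let $d\ge 1$ and let $X\subset\mathbb R^d$ be a finite set of $n>d+1$ points in general position (no $d+1$ of them lie in a hyperplane); let $C=\operatorname{conv}(X)$. Definitions. A \emph{ridge} is a subset of $X$ with $d-1$ elements. For $k\ge1$, $\mathcal H(k)$ denotes the set of closed halfspaces $H$ whose bounding hyperplane $\partial H$ is the affine hull of $d$ points of $X$ and which cut off exactly $k-1$ points, i.e. $|X\setminus H|=k-1$. Two elements of $\mathcal H(k)$ are \emph{neighbouring} if their bounding hyperplanes contain a common ridge; \emph{reachable} is the transitive closure of this relation on $\mathcal H(k)$, and the \emph{orbit} of $H\in\mathcal H(k)$ is the set of elements of $\mathcal H(k)$ reachable from $H$. The Tukey depth of $x\in\mathbb R^d$ is $\mathrm{HD}(x;X)=\min_{\|u\|=1}|\{y\in X:\langle x,u\rangle\le\langle y,u\rangle\}|$, and $\mathrm{HD}_k(X)=\{x:\mathrm{HD}(x;X)\ge k\}$. Algorithm (A) at level $k$ starts with an arbitrary ridge $I$ on the boundary of $C$ (that is, $\operatorname{conv}(I)\subset\partial C$). Its initial queue $\mathcal Q$ consists of (i) all ridges contained in $\partial H$ for some $H\in\mathcal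 H(k)$ with $I\subset\partial H$, and (ii) all ridges formed by $d-2$ points of $I$ and one point cut off by such an $H$ (none if $d=1$). From every ridge $J\in\mathcal Q$ it then performs a breadth-first search: first all $H\in\mathcal H(k)$ with $J\subset\partial H$ are found, and in each further round all halfspaces of $\mathcal H(k)$ whose boundary contains a ridge lying in the boundary of an already found halfspace are added, until nothing new is found. Let $\mathcal H_k$ be the set of all halfspaces found; the algorithm returns $\bigcap\mathcal H_k$. Two vertices $x,x'$ of $C$ are \emph{vertex-neighbouring} if there is a set $V$ of $d-1$ vertices of $C$, different from $x$ and $x'$, such that $\operatorname{conv}(V\cup\{x\})$ and $\operatorname{conv}(V\cup\{x'\})$ are both facets of $C$; \emph{vertex-reachable} is the transitive closure of this relation. Theorem. (a) A starting ridge on the boundary of $C$ exists, and for $k\in\{1,2\}$ and every such starting ridge, Algorithm (A) finds all of $\mathcal H(k)$ after finitely many rounds, i.e. $\mathcal H_k=\mathcal H(k)$, and it is exact: $\bigcap\mathcal H_k=\mathrm{HD}_k(X)$. (b) $\mathcal H(1)$ is non-empty, consists exactly of the closed halfspaces determined by the facets of $C$ (the closed halfspaces that contain $C$ and whose bounding hyperplane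 meets $C$ in a facet), and forms a single orbit. (c) Any two halfspaces in $\mathcal H(2)$ that cut off the same point of $X$ are reachable from one another in $\mathcal H(2)$. (d) If $F$ is a facet of $C$, then every vertex of $C$ is vertex-reachable from some vertex of $F$. -/

import Mathlib

namespace TukeyDepth

/-- Points of `ℝ^d` with the Euclidean inner product. -/
abbrev Pt (d : ℕ) : Type := EuclideanSpace ℝ (Fin d)

/-- General position: no `d + 1` points of `X` lie in a common hyperplane
`{z | ⟪u, z⟫ = c}`, `u ≠ 0`. -/
def GeneralPosition {d : ℕ} (X : Finset (Pt d)) : Prop :=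
  ∀ S : Finset (Pt d), S ⊆ X → S.card = d + 1 →
    ¬ ∃ (u : Pt d) (c : ℝ), u ≠ 0 ∧ ∀ y ∈ S, inner ℝ u y = c

/-- Closed halfspaces `{z | ⟪u, z⟫ ≤ c}`, `u ≠ 0`. The bounding hyperplane is `frontier H`. -/
def IsClosedHalfspace {d : ℕ} (H : Set (Pt d)) : Prop :=
  ∃ (u : Pt d) (c : ℝ), u ≠ 0 ∧ H = {z | inner ℝ u z ≤ c}

/-- A closed halfspace whose bounding hyperplane is the affine hull of `d` points of `X`. -/
def IsObservational {d : ℕ} (X : Finset (Pt d)) (H : Set (Pt d)) : Prop :=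
  IsClosedHalfspace H ∧
    ∃ S : Finset (Pt d), S ⊆ X ∧ S.card = d ∧
      frontier H = (affineSpan ℝ (S : Set (Pt d)) : Set (Pt d))

/-- The points of `X` cut off by `H`. -/
def cutOff {d : ℕ} (X : Finset (Pt d)) (H : Set (Pt d)) : Set (Pt d) :=
  (X : Set (Pt d)) \ H

/-- `ℋ(k)`: the relevant halfspaces at level `k`, i.e. the observational halfspaces that cut
off exactly `k - 1` points. -/
def relevant {d : ℕ} (X : Finset (Pt d)) (k : ℕ) : Set (Set (Pt d)) :=
  {H | IsObservational X H ∧ (cutOff X H).ncard + 1 = k}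

/-- A ridge: a set of `d - 1` points of `X`. -/
def IsRidge {d : ℕ} (X J : Finset (Pt d)) : Prop :=
  J ⊆ X ∧ J.card + 1 = d

/-- Two relevant halfspaces whose boundaries contain a common ridge. -/
def Neighbouring {d : ℕ} (X : Finset (Pt d)) (k : ℕ) (H H' : Set (Pt d)) : Prop :=
  H ∈ relevant X k ∧ H' ∈ relevant X k ∧
    ∃ J : Finset (Pt d), IsRidge X J ∧
      (J : Set (Pt d)) ⊆ frontier H ∧ (J : Set (Pt d)) ⊆ frontier H'

/-- Reachability in `ℋ(k)`: the transitive closure of neighbouring. -/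
def Reachable {d : ℕ} (X : Finset (Pt d)) (k : ℕ) : Set (Pt d) → Set (Pt d) → Prop :=
  Relation.TransGen (Neighbouring X k)

/-- The orbit of `H` in `ℋ(k)`. -/
def orbit {d : ℕ} (X : Finset (Pt d)) (k : ℕ) (H : Set (Pt d)) : Set (Set (Pt d)) :=
  {H' | Reachable X k H H'}

/-- The relevant halfspaces at level `k` that contain `J` in their boundary. -/
def relevantThrough {d : ℕ} (X : Finset (Pt d)) (k : ℕ) (J : Finset (Pt d)) :
    Set (Set (Pt d)) :=
  {H | H ∈ relevant X k ∧ (J : Set (Pt d)) ⊆ frontier H}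

/-- Breadth-first search from the ridge `I`, after `m` rounds. First all halfspaces of `ℋ(k)`
through `I` are found; each further round adds all halfspaces of `ℋ(k)` through any ridge
contained in the boundary of a halfspace that was found before. -/
def searchFrom {d : ℕ} (X : Finset (Pt d)) (k : ℕ) (I : Finset (Pt d)) :
    ℕ → Set (Set (Pt d))
  | 0 => relevantThrough X k I
  | m + 1 => searchFrom X k I m ∪
      {H | ∃ G ∈ searchFrom X k I m, ∃ J : Finset (Pt d), IsRidge X J ∧
        (J : Set (Pt d)) ⊆ frontier G ∧ H ∈ relevantThrough X k J}

/-- The halfspaces found by the ridge search with initial queue `Q` after `m` rounds of the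
search from each ridge in the queue. -/
def ridgeSearchRounds {d : ℕ} (X : Finset (Pt d)) (k : ℕ) (Q : Set (Finset (Pt d))) (m : ℕ) :
    Set (Set (Pt d)) :=
  {H | ∃ I ∈ Q, H ∈ searchFrom X k I m}

/-- The set of all halfspaces ever found by the ridge search with initial queue `Q`. -/
def ridgeSearch {d : ℕ} (X : Finset (Pt d)) (k : ℕ) (Q : Set (Finset (Pt d))) :
    Set (Set (Pt d)) :=
  {H | ∃ m : ℕ, H ∈ ridgeSearchRounds X k Q m}

/-- The convex hull of the data. -/
def hull {d : ℕ} (X : Finset (Pt d)) : Set (Pt d) :=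
  convexHull ℝ (X : Set (Pt d))

/-- A ridge on the boundary of the convex hull of `X`, as an admissible starting ridge: the
whole simplex spanned by it, not only its vertices, lies in the boundary. -/
def IsHullRidge {d : ℕ} (X I : Finset (Pt d)) : Prop :=
  IsRidge X I ∧ convexHull ℝ (I : Set (Pt d)) ⊆ frontier (hull X)

/-- The initial queue of Algorithm (A) started at the ridge `I`: all ridges in the boundaries of
the relevant halfspaces through `I`, and all ridges formed by `d - 2` points of `I` and one point
cut off by one of these halfspaces. -/
def queueA {d : ℕ} (X : Finset (Pt d)) (k : ℕ) (I : Finset (Pt d)) : Set (Finset (Pt d)) :=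
  {J | ∃ H ∈ relevantThrough X k I, IsRidge X J ∧ (J : Set (Pt d)) ⊆ frontier H} ∪
  {J | ∃ H ∈ relevantThrough X k I, ∃ y ∈ cutOff X H, ∃ K : Finset (Pt d),
    K ⊆ I ∧ K.card + 2 = d ∧ (J : Set (Pt d)) = insert y (K : Set (Pt d))}

/-- The set of relevant halfspaces found by Algorithm (A) started at the ridge `I`. -/
def algorithmA {d : ℕ} (X : Finset (Pt d)) (k : ℕ) (I : Finset (Pt d)) : Set (Set (Pt d)) :=
  ridgeSearch X k (queueA X k I)

/-- The (integer-valued) Tukey depth of `x` with respect to `X`. -/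
noncomputable def depth {d : ℕ} (X : Finset (Pt d)) (x : Pt d) : ℕ :=
  ⨅ u : Metric.sphere (0 : Pt d) 1,
    {y : Pt d | y ∈ X ∧ inner ℝ x (u : Pt d) ≤ inner ℝ y (u : Pt d)}.ncard

/-- The central region at level `k`. -/
def centralRegion {d : ℕ} (X : Finset (Pt d)) (k : ℕ) : Set (Pt d) :=
  {x | k ≤ depth X x}

/-- A facet of a convex set `C` in `ℝ^d`: a face of dimension `d - 1`. -/
def IsFacet {d : ℕ} (C F : Set (Pt d)) : Prop :=
  Convex ℝ F ∧ IsExtreme ℝ C F ∧ F.Nonempty ∧ Module.finrank ℝ (vectorSpan ℝ F) + 1 = d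

/-- The closed halfspaces determined by the facets of the convex hull of `X`. -/
def facetHalfspaces {d : ℕ} (X : Finset (Pt d)) : Set (Set (Pt d)) :=
  {H | IsClosedHalfspace H ∧ hull X ⊆ H ∧ IsFacet (hull X) (hull X ∩ frontier H)}

/-- Vertex-neighbouring vertices `x`, `x'` of the convex hull `C` of `X`: for some `d - 1`
vertices `V` of `C` other than `x`, `x'`, both `conv (V ∪ {x})` and `conv (V ∪ {x'})` are
facets of `C`. -/
def VertexNeighbouring {d : ℕ} (X : Finset (Pt d)) (x x' : Pt d) : Prop :=
  x ∈ (hull X).extremePoints ℝ ∧ x' ∈ (hull X).extremePoints ℝ ∧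
    ∃ V : Finset (Pt d), (V : Set (Pt d)) ⊆ (hull X).extremePoints ℝ ∧ V.card + 1 = d ∧
      x ∉ V ∧ x' ∉ V ∧
      IsFacet (hull X) (convexHull ℝ (insert x (V : Set (Pt d)))) ∧
      IsFacet (hull X) (convexHull ℝ (insert x' (V : Set (Pt d))))

/-- Vertex-reachability: the transitive closure of vertex-neighbouring. -/
def VertexReachable {d : ℕ} (X : Finset (Pt d)) : Pt d → Pt d → Prop :=
  Relation.TransGen (VertexNeighbouring X)

end TukeyDepth

open TukeyDepth

/-!
Everything is expressed through affine functions `f` on `ℝ^d`, which form a vector space of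
dimension `d + 1`. General position says that only `f = 0` vanishes at `d + 1` points of `X`. For
`Y ⊆ X`, the facets of `conv Y` are the functions `f` with `f ≤ 0` on `Y` and exactly `d` zeros in
`Y`, up to positive multiples (`IsFacetFun`); they span the extreme rays of a simple polyhedral
cone. The level-one halfspaces are the facets of `conv X`, and the level-two halfspaces cutting off
`x` are the facets of `conv (X \ {x})` with `f x > 0`.

The connectivity statements all follow from `IsFacetFun.reflTransGen`: for a linear functional `N`,
the facets with `N f > 0` are connected through ridges. To travel to a facet `f'`, run the simplex
method on the slice `N f = 1` of the cone, maximizing the sum of the values at the zeros of `f'`.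
This objective is nonpositive on the cone and vanishes, on the slice, only at `f'`, so the
possibly unbounded slice does no harm. With `N f = -∑ y, f y` over the points of `X` this connects the
facets of `conv X` (level one, and vertex-reachability along a path of facets); with `N` the
evaluation at `x` it connects the level-two halfspaces that cut off `x`.

At level two, rotating a facet about the ridge opposite to its vertex `z` yields a halfspace that
cuts off exactly `z` (`IsFacetFun.exists_swap`). Applied to the facet through the starting ridge,
this shows that the initial queue reaches halfspaces cutting off each vertex of that facet. Applied
to two facets over a common ridge, it gives neighbouring halfspaces that cut off the two apices, so
the search spreads along a path of facets to every point that can be cut off.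

A point of depth less than `k` lies outside `conv X` or, if `k = 2`, outside `conv (X \ {y})` for
some `y`, hence is separated by a facet of this hull, which belongs to level one or two. That the
level-one halfspaces are redundant at level two is `exists_relevant_two_of_notMem_hull`.
-/

namespace TukeyDepth

/-! ### Uniform arrangements of linear functionals -/

section Arrangement

open Module

variable {V α : Type*} [AddCommGroup V] [Module ℝ V]

/-- The functionals `e y`, `y ∈ Y`, are in general position with respect to `V`, `dim V = d + 1`:
only the zero vector is annihilated by `d + 1` of them. -/
def Uniform (e : α → V →ₗ[ℝ] ℝ) (d : ℕ) (Y : Finset α) : Prop :=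
  ∀ S ⊆ Y, S.card = d + 1 → ∀ f, (∀ s ∈ S, e s f = 0) → f = 0

open Classical in
/-- The indices in `Y` whose functionals vanish at `f`. -/
noncomputable def zeros (e : α → V →ₗ[ℝ] ℝ) (Y : Finset α) (f : V) : Finset α :=
  {y ∈ Y | e y f = 0}

/-- `f` spans an extreme ray of the cone `{f | ∀ y ∈ Y, e y f ≤ 0}`, provided that `Y` is uniform:
exactly `d` of the defining inequalities are tight. If `V` consists of the affine functions on
`ℝ^d` and `e` of the evaluations, then `{f ≤ 0}` is the halfspace of a facet of `conv Y`. -/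
structure IsFacetFun (e : α → V →ₗ[ℝ] ℝ) (d : ℕ) (Y : Finset α) (f : V) : Prop where
  nonpos : ∀ y ∈ Y, e y f ≤ 0
  card_zeros : (zeros e Y f).card = d

/-- `f` and `f'` have `d - 1` common zeros in `Y`. -/
def SharesRidge (e : α → V →ₗ[ℝ] ℝ) (d : ℕ) (Y : Finset α) (f f' : V) : Prop :=
  ∃ J ⊆ Y, J.card + 1 = d ∧ (∀ s ∈ J, e s f = 0) ∧ ∀ s ∈ J, e s f' = 0

/-- Adjacency of the facets of `Y` on which the functional `N` is positive. -/
def FacetAdj (e : α → V →ₗ[ℝ] ℝ) (d : ℕ) (Y : Finset α) (N : V →ₗ[ℝ] ℝ) (f f' : V) : Prop :=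
  (IsFacetFun e d Y f ∧ 0 < N f) ∧ (IsFacetFun e d Y f' ∧ 0 < N f') ∧ SharesRidge e d Y f f'

variable {e : α → V →ₗ[ℝ] ℝ} {d : ℕ} {X Y Z S J : Finset α} {N : V →ₗ[ℝ] ℝ} {f f' g h : V}

theorem mem_zeros {y : α} : y ∈ zeros e Y f ↔ y ∈ Y ∧ e y f = 0 := by
  simp [zeros]

theorem zeros_subset : zeros e Y f ⊆ Y := Finset.filter_subset _ _

theorem zeros_smul {c : ℝ} (hc : c ≠ 0) : zeros e Y (c • f) = zeros e Y f := by
  ext y; simp [mem_zeros, hc]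

theorem Uniform.mono (hX : Uniform e d X) (h : Y ⊆ X) : Uniform e d Y :=
  fun S hS => hX S (hS.trans h)

theorem Uniform.eq_zero (hY : Uniform e d Y) (hS : S ⊆ Y) (hc : d < S.card)
    (hf : ∀ s ∈ S, e s f = 0) : f = 0 := by
  obtain ⟨T, hT, hTc⟩ := Finset.exists_subset_card_eq (Nat.succ_le_of_lt hc)
  exact hY T (hT.trans hS) hTc f fun s hs => hf s (hT hs)

theorem Uniform.card_zeros_le (hY : Uniform e d Y) (hf : f ≠ 0) : (zeros e Y f).card ≤ d := by
  by_contra! hc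
  exact hf (hY.eq_zero zeros_subset hc fun s hs => (mem_zeros.1 hs).2)

theorem Uniform.zeros_eq (hY : Uniform e d Y) (hf : f ≠ 0) (hS : S ⊆ Y) (hc : S.card = d)
    (h0 : ∀ s ∈ S, e s f = 0) : zeros e Y f = S :=
  (Finset.eq_of_subset_of_card_le (fun s hs => mem_zeros.2 ⟨hS hs, h0 s hs⟩)
    (hc ▸ hY.card_zeros_le hf)).symm

/-- A vector that vanishes on the `d` zeros of `f` is a multiple of `f`. -/
theorem Uniform.cross_eq (hY : Uniform e d Y) (hf : (zeros e Y f).card = d)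
    (hg : ∀ s ∈ zeros e Y f, e s g = 0) {y : α} (hy : y ∈ Y) (hyf : e y f ≠ 0) :
    e y f • g = e y g • f := by
  classical
  have hyz : y ∉ zeros e Y f := fun h => hyf (mem_zeros.1 h).2
  refine sub_eq_zero.1 (hY (insert y (zeros e Y f)) ?_ ?_ _ ?_)
  · exact Finset.insert_subset hy zeros_subset
  · rw [Finset.card_insert_of_notMem hyz, hf]
  · intro s hs
    rcases Finset.mem_insert.1 hs with rfl | hs
    · simp [mul_comm]
    · simp [hg s hs, (mem_zeros.1 hs).2]

theorem Uniform.sum_neg (hY : Uniform e d Y) (hn : d < Y.card) (hf : ∀ y ∈ Y, e y f ≤ 0)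
    (h0 : f ≠ 0) : ∑ y ∈ Y, e y f < 0 := by
  refine (Finset.sum_nonpos hf).lt_of_ne fun h => h0 ?_
  exact hY.eq_zero subset_rfl hn ((Finset.sum_eq_zero_iff_of_nonpos hf).1 h)

theorem IsFacetFun.neg (hf : IsFacetFun e d Y f) {y : α} (hy : y ∈ Y) (hyz : y ∉ zeros e Y f) :
    e y f < 0 :=
  lt_of_le_of_ne (hf.nonpos y hy) fun h => hyz (mem_zeros.2 ⟨hy, h⟩)

theorem IsFacetFun.smul (hf : IsFacetFun e d Y f) {c : ℝ} (hc : 0 < c) :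
    IsFacetFun e d Y (c • f) where
  nonpos y hy := by
    simpa using mul_nonpos_of_nonneg_of_nonpos hc.le (hf.nonpos y hy)
  card_zeros := by rw [zeros_smul hc.ne', hf.card_zeros]

theorem IsFacetFun.sdiff_nonempty (hf : IsFacetFun e d Y f) (hn : d < Y.card) :
    ∃ y ∈ Y, y ∉ zeros e Y f :=
  Finset.exists_mem_notMem_of_card_lt_card (by rwa [hf.card_zeros])

theorem IsFacetFun.ne_zero (hf : IsFacetFun e d Y f) (hn : d < Y.card) : f ≠ 0 := by
  rintro rfl
  obtain ⟨y, hy, hyz⟩ := hf.sdiff_nonempty hn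
  exact hyz (mem_zeros.2 ⟨hy, by simp⟩)

theorem IsFacetFun.exists_ridge (hf : IsFacetFun e d Y f) (hd : 1 ≤ d) :
    ∃ J ⊆ zeros e Y f, J.card + 1 = d := by
  obtain ⟨J, hJ, hc⟩ := Finset.exists_subset_card_eq
    (show d - 1 ≤ (zeros e Y f).card by rw [hf.card_zeros]; omega)
  exact ⟨J, hJ, by omega⟩

theorem sharesRidge_of_zeros (hf : IsFacetFun e d Y f) (hd : 1 ≤ d)
    (hf' : ∀ s ∈ zeros e Y f, e s f' = 0) : SharesRidge e d Y f f' := by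
  obtain ⟨J, hJ, hc⟩ := hf.exists_ridge hd
  exact ⟨J, hJ.trans zeros_subset, hc, fun s hs => (mem_zeros.1 (hJ hs)).2,
    fun s hs => hf' s (hJ hs)⟩

theorem exists_ne_zero_vanishing [FiniteDimensional ℝ V] (hV : finrank ℝ V = d + 1)
    (e : α → V →ₗ[ℝ] ℝ) (hS : S.card ≤ d) : ∃ h : V, h ≠ 0 ∧ ∀ s ∈ S, e s h = 0 := by
  have := LinearMap.ker_ne_bot_of_finrank_lt (f := LinearMap.pi fun s : S => e s)
    (by simp [hV]; omega)
  obtain ⟨h, hk, h0⟩ := Submodule.exists_mem_ne_zero_of_ne_bot this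
  exact ⟨h, h0, fun s hs => congrFun (LinearMap.mem_ker.1 hk) ⟨s, hs⟩⟩

/-- For `s` among `d` indices of `Y`, some vector vanishes on the others but not on `s`. -/
theorem Uniform.exists_dual [FiniteDimensional ℝ V] (hV : finrank ℝ V = d + 1)
    (hY : Uniform e d Y) (hn : d < Y.card) (hS : S ⊆ Y) (hc : S.card = d) {s : α} (hs : s ∈ S)
    (r : ℝ) : ∃ h : V, e s h = r ∧ ∀ t ∈ S, t ≠ s → e t h = 0 := by
  classical
  obtain ⟨y, hy, hyS⟩ := Finset.exists_mem_notMem_of_card_lt_card (hc.trans_lt hn)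
  have hins : (insert y (S.erase s)).card ≤ d := by
    have := Finset.card_insert_le y (S.erase s)
    have h1 := Finset.card_erase_add_one hs
    omega
  obtain ⟨h, h0, hh⟩ := exists_ne_zero_vanishing hV e hins
  have hsh : e s h ≠ 0 := by
    intro h1
    refine h0 (hY (insert y S) (Finset.insert_subset hy hS) ?_ h ?_)
    · rw [Finset.card_insert_of_notMem hyS, hc]
    · intro t ht
      by_cases hts : t = s
      · rwa [hts]
      · exact hh t (by simp only [Finset.mem_insert, Finset.mem_erase] at ht ⊢; tauto)
  refine ⟨(r / e s h) • h, by simp [hsh], fun t ht hts => ?_⟩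
  simp [hh t (Finset.mem_insert_of_mem (Finset.mem_erase.2 ⟨hts, ht⟩))]

/-- The ratio test of the simplex method: if `f` is negative off `Z`, then some `h + t • f` is
nonpositive off `Z` and touches zero there. -/
theorem exists_pivot (hZ : ∃ y ∈ Y, y ∉ Z) (hf : ∀ y ∈ Y, y ∉ Z → e y f < 0) (h : V) :
    ∃ t : ℝ, (∃ y ∈ Y, y ∉ Z ∧ e y (h + t • f) = 0) ∧
      ∀ y ∈ Y, y ∉ Z → e y (h + t • f) ≤ 0 := by
  classical
  obtain ⟨y0, hy0, hy0Z⟩ := hZ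
  obtain ⟨y, hy, hmax⟩ := Finset.exists_max_image (Y \ Z) (fun y => e y h / (-e y f))
    ⟨y0, Finset.mem_sdiff.2 ⟨hy0, hy0Z⟩⟩
  obtain ⟨hyY, hyZ⟩ := Finset.mem_sdiff.1 hy
  refine ⟨e y h / (-e y f), ⟨y, hyY, hyZ, ?_⟩, fun x hx hxZ => ?_⟩
  · have := (hf y hyY hyZ).ne
    simp only [map_add, map_smul, smul_eq_mul]
    field_simp
    ring
  · have h1 := hmax x (Finset.mem_sdiff.2 ⟨hx, hxZ⟩)
    have h2 := hf x hx hxZ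
    rw [div_le_iff₀ (by linarith)] at h1
    simp only [map_add, map_smul, smul_eq_mul]
    linarith

/-- Every vector of the cone `{f | ∀ y ∈ Y, e y f ≤ 0}` lies on a face all of whose extreme rays
vanish where it vanishes; one of them is positive for any `N` that is positive at the vector. -/
theorem Uniform.exists_facetFun [FiniteDimensional ℝ V] (hV : finrank ℝ V = d + 1)
    (hY : Uniform e d Y) (hn : d < Y.card) (hf : ∀ y ∈ Y, e y f ≤ 0) (hN : 0 < N f) :
    ∃ g, IsFacetFun e d Y g ∧ 0 < N g ∧ zeros e Y f ⊆ zeros e Y g := by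
  classical
  -- Take an admissible vector with as many zeros as possible.
  let P : ℕ → Prop := fun m => ∃ g, (∀ y ∈ Y, e y g ≤ 0) ∧ 0 < N g ∧
    zeros e Y f ⊆ zeros e Y g ∧ (zeros e Y g).card = m
  have hne : ∀ g, 0 < N g → g ≠ 0 := by rintro g hg rfl; simp at hg
  have hP0 : P (zeros e Y f).card := ⟨f, hf, hN, subset_rfl, rfl⟩
  have hb : (zeros e Y f).card ≤ d := hY.card_zeros_le (hne f hN)
  obtain ⟨g, hg, hNg, hsub, hcard⟩ := Nat.findGreatest_spec hb hP0
  refine ⟨g, ⟨hg, ?_⟩, hNg, hsub⟩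
  by_contra hcd
  have hlt : (zeros e Y g).card < d := lt_of_le_of_ne (hY.card_zeros_le (hne g hNg)) hcd
  have hneg : ∀ y ∈ Y, y ∉ zeros e Y g → e y g < 0 := fun y hy hyz =>
    lt_of_le_of_ne (hg y hy) fun h => hyz (mem_zeros.2 ⟨hy, h⟩)
  -- A direction with `N = 0` that keeps the zeros of `g` and is positive somewhere.
  obtain ⟨h, hN0, hz, y, hy, hpos⟩ : ∃ h : V, N h = 0 ∧ (∀ s ∈ zeros e Y g, e s h = 0) ∧
      ∃ y ∈ Y, 0 < e y h := by
    let e' : Option α → V →ₗ[ℝ] ℝ := fun o => o.elim N e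
    obtain ⟨h, h0, hh⟩ := exists_ne_zero_vanishing hV e'
      (S := Finset.insertNone (zeros e Y g)) (by simpa using hlt)
    have hN0 : N h = 0 := hh none (by simp)
    have hz : ∀ s ∈ zeros e Y g, e s h = 0 := fun s hs => hh (some s) (by simpa using hs)
    have : ∃ y ∈ Y, e y h ≠ 0 := by
      by_contra! hall
      exact h0 (hY.eq_zero subset_rfl hn hall)
    obtain ⟨y, hy, hyh⟩ := this
    rcases lt_or_gt_of_ne hyh with hl | hl
    · exact ⟨-h, by simp [hN0], fun s hs => by simp [hz s hs], y, hy, by simpa using hl⟩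
    · exact ⟨h, hN0, hz, y, hy, hl⟩
  have hyz : y ∉ zeros e Y g := fun h' => hpos.ne' (hz y h')
  obtain ⟨t, ⟨x, hx, hxz, hx0⟩, ht⟩ := exists_pivot ⟨y, hy, hyz⟩ hneg h
  have htpos : 0 < t := by
    have h1 := ht y hy hyz
    have h2 := hneg y hy hyz
    simp only [map_add, map_smul, smul_eq_mul] at h1
    by_contra! hle
    nlinarith
  have hz' : ∀ s ∈ zeros e Y g, e s (h + t • g) = 0 := fun s hs => by
    simp [hz s hs, (mem_zeros.1 hs).2]
  have hss : insert x (zeros e Y g) ⊆ zeros e Y (h + t • g) := by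
    refine Finset.insert_subset (mem_zeros.2 ⟨hx, hx0⟩) fun s hs => ?_
    exact mem_zeros.2 ⟨(mem_zeros.1 hs).1, hz' s hs⟩
  have hNn : 0 < N (h + t • g) := by simpa [hN0] using mul_pos htpos hNg
  have hnew : P (zeros e Y (h + t • g)).card := by
    refine ⟨_, fun y hy => ?_, hNn, hsub.trans ((Finset.subset_insert _ _).trans hss), rfl⟩
    by_cases hyz : y ∈ zeros e Y g
    · exact (hz' y hyz).le
    · exact ht y hy hyz
  have h1 := Nat.le_findGreatest (hY.card_zeros_le (hne _ hNn)) hnew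
  have h2 := Finset.card_le_card hss
  rw [Finset.card_insert_of_notMem hxz] at h2
  omega

/-- The improving step of the simplex method: among the facets with `N = 1`, one that differs from
`f₀` has a neighbour on which the sum of the functionals in the zeros of `f₀` is larger. -/
theorem IsFacetFun.exists_improving [FiniteDimensional ℝ V] (hV : finrank ℝ V = d + 1)
    (hY : Uniform e d Y) (hn : d < Y.card) {f₀ : V} (hf : IsFacetFun e d Y f) (hNf : N f = 1)
    (hf₀ : IsFacetFun e d Y f₀) (hNf₀ : N f₀ = 1)
    (hlt : ∑ s ∈ zeros e Y f₀, e s f < 0) :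
    ∃ g, IsFacetFun e d Y g ∧ N g = 1 ∧ SharesRidge e d Y f g ∧
      ∑ s ∈ zeros e Y f₀, e s f < ∑ s ∈ zeros e Y f₀, e s g := by
  classical
  let φ : V →ₗ[ℝ] ℝ := ∑ s ∈ zeros e Y f₀, e s
  have hφ : ∀ g, φ g = ∑ s ∈ zeros e Y f₀, e s g := fun g => by simp [φ]
  simp only [← hφ] at hlt ⊢
  have hφf₀ : φ f₀ = 0 := by
    rw [hφ]; exact Finset.sum_eq_zero fun s hs => (mem_zeros.1 hs).2
  -- The edge directions at `f`.
  have hdir : ∀ s ∈ zeros e Y f, ∃ h : V, N h = 0 ∧ e s h = -1 ∧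
      ∀ t ∈ zeros e Y f, t ≠ s → e t h = 0 := by
    intro s hs
    obtain ⟨h, h1, h2⟩ := hY.exists_dual hV hn zeros_subset hf.card_zeros hs (-1)
    refine ⟨h - N h • f, by simp [hNf], by simp [h1, (mem_zeros.1 hs).2], fun t ht hts => ?_⟩
    simp [h2 t ht hts, (mem_zeros.1 ht).2]
  choose! b hbN hb1 hb2 using hdir
  obtain ⟨y, hy, hyz⟩ := hf.sdiff_nonempty hn
  -- `f₀ - f` is a combination of edge directions with nonnegative coefficients.
  have hsum : f₀ - f = ∑ s ∈ zeros e Y f, (-e s f₀) • b s := by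
    have hv : ∀ t ∈ zeros e Y f, e t (f₀ - f - ∑ s ∈ zeros e Y f, (-e s f₀) • b s) = 0 := by
      intro t ht
      have : ∑ s ∈ zeros e Y f, (-e s f₀) * e t (b s) = e t f₀ := by
        rw [Finset.sum_eq_single_of_mem t ht]
        · simp [hb1 t ht]
        · intro s hs hst
          rw [hb2 s hs t ht hst.symm, mul_zero]
      simp only [map_sub, map_sum, map_smul, smul_eq_mul, this, (mem_zeros.1 ht).2]
      ring
    have hc := hY.cross_eq hf.card_zeros hv hy (hf.neg hy hyz).ne
    have hNv : N (f₀ - f - ∑ s ∈ zeros e Y f, (-e s f₀) • b s) = 0 := by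
      simp only [map_sub, map_sum, map_smul, smul_eq_mul, hNf, hNf₀]
      rw [Finset.sum_eq_zero fun s hs => by rw [hbN s hs, mul_zero]]
      ring
    have hc2 := congrArg N hc
    rw [map_smul, map_smul, hNv, hNf, smul_zero, smul_eq_mul, mul_one] at hc2
    rw [← hc2, zero_smul] at hc
    exact sub_eq_zero.1 ((smul_eq_zero.1 hc).resolve_left (hf.neg hy hyz).ne)
  have hφs : ∃ s ∈ zeros e Y f, 0 < φ (b s) := by
    by_contra! hall
    have h1 := congrArg φ hsum
    simp only [map_sub, map_sum, map_smul, smul_eq_mul, hφf₀] at h1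
    have h2 : ∑ s ∈ zeros e Y f, (-e s f₀) * φ (b s) ≤ 0 :=
      Finset.sum_nonpos fun s hs => mul_nonpos_of_nonneg_of_nonpos
        (by linarith [hf₀.nonpos s (zeros_subset hs)]) (hall s hs)
    linarith
  obtain ⟨s, hs, hφs⟩ := hφs
  obtain ⟨t, ⟨x, hx, hxz, hx0⟩, ht⟩ := exists_pivot ⟨y, hy, hyz⟩
    (fun y hy hyz => hf.neg hy hyz) (b s)
  -- The edge is bounded, since `φ ≤ 0` on the cone.
  have htpos : 0 < t := by
    by_contra! hle
    have : φ (b s) ≤ 0 := by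
      rw [hφ]
      refine Finset.sum_nonpos fun z hz => ?_
      have hzY := zeros_subset hz
      by_cases hzf : z ∈ zeros e Y f
      · by_cases hzs : z = s
        · rw [hzs, hb1 s hs]; norm_num
        · rw [hb2 s hs z hzf hzs]
      · have h1 := ht z hzY hzf
        have h2 := hf.neg hzY hzf
        simp only [map_add, map_smul, smul_eq_mul] at h1
        nlinarith
    linarith
  have h0 : b s + t • f ≠ 0 := by
    intro h0
    have := congrArg N h0
    simp [hbN s hs, hNf, htpos.ne'] at this
  have hzero : ∀ z ∈ zeros e Y f, z ≠ s → e z (b s + t • f) = 0 := fun z hz hzs => by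
    simp [hb2 s hs z hz hzs, (mem_zeros.1 hz).2]
  have hfac : IsFacetFun e d Y (b s + t • f) := by
    refine ⟨fun z hz => ?_, ?_⟩
    · by_cases hzf : z ∈ zeros e Y f
      · by_cases hzs : z = s
        · rw [hzs]; simp [hb1 s hs, (mem_zeros.1 hs).2]
        · exact (hzero z hzf hzs).le
      · exact ht z hz hzf
    · refine le_antisymm (hY.card_zeros_le h0) ?_
      have hsub : insert x ((zeros e Y f).erase s) ⊆ zeros e Y (b s + t • f) := by
        refine Finset.insert_subset (mem_zeros.2 ⟨hx, hx0⟩) fun z hz => ?_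
        obtain ⟨hzs, hz⟩ := Finset.mem_erase.1 hz
        exact mem_zeros.2 ⟨zeros_subset hz, hzero z hz hzs⟩
      have := Finset.card_le_card hsub
      rwa [Finset.card_insert_of_notMem fun h => hxz (Finset.mem_of_mem_erase h),
        Finset.card_erase_add_one hs, hf.card_zeros] at this
  refine ⟨t⁻¹ • (b s + t • f), hfac.smul (inv_pos.2 htpos), ?_, ?_, ?_⟩
  · simp [hbN s hs, hNf, htpos.ne']
  · refine ⟨(zeros e Y f).erase s, (Finset.erase_subset _ _).trans zeros_subset, ?_, ?_, ?_⟩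
    · rw [Finset.card_erase_add_one hs, hf.card_zeros]
    · exact fun z hz => (mem_zeros.1 (Finset.mem_of_mem_erase hz)).2
    · intro z hz
      obtain ⟨hzs, hz⟩ := Finset.mem_erase.1 hz
      rw [map_smul, hzero z hz hzs, smul_zero]
  · have : φ (t⁻¹ • (b s + t • f)) = t⁻¹ * φ (b s) + φ f := by
      simp only [map_smul, map_add, smul_eq_mul]
      field_simp
    rw [this]
    linarith [mul_pos (inv_pos.2 htpos) hφs]

/-- The facets on which `N` is positive are connected through ridges. Starting from any facet, the
simplex method for the sum of the functionals in the zeros of `f'` ends at `f'`. -/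
theorem IsFacetFun.reflTransGen [FiniteDimensional ℝ V] (hV : finrank ℝ V = d + 1) (hd : 1 ≤ d)
    (hY : Uniform e d Y) (hn : d < Y.card) (hf : IsFacetFun e d Y f) (hNf : 0 < N f)
    (hf' : IsFacetFun e d Y f') (hNf' : 0 < N f') :
    Relation.ReflTransGen (FacetAdj e d Y N) f f' := by
  classical
  set f₀ := (N f')⁻¹ • f' with hf₀def
  have hf₀ : IsFacetFun e d Y f₀ := hf'.smul (inv_pos.2 hNf')
  have hNf₀ : N f₀ = 1 := by simp [hf₀def, hNf'.ne']
  let T : Set V := {g | IsFacetFun e d Y g ∧ N g = 1 ∧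
    Relation.ReflTransGen (FacetAdj e d Y N) f g}
  have hfin : T.Finite := by
    refine Set.Finite.of_finite_image (f := zeros e Y)
      ((Finset.finite_toSet Y.powerset).subset ?_) ?_
    · rintro _ ⟨g, -, rfl⟩
      exact Finset.mem_coe.2 (Finset.mem_powerset.2 zeros_subset)
    · rintro g ⟨hg, hNg, -⟩ g' ⟨hg', hNg', -⟩ hz
      obtain ⟨y, hy, hyz⟩ := hg.sdiff_nonempty hn
      have hz' : zeros e Y g = zeros e Y g' := hz
      have hc := hY.cross_eq hg.card_zeros (g := g')
        (fun s hs => (mem_zeros.1 (hz' ▸ hs)).2) hy (hg.neg hy hyz).ne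
      have hc2 := congrArg N hc
      rw [map_smul, map_smul, hNg, hNg', smul_eq_mul, smul_eq_mul, mul_one, mul_one] at hc2
      rw [← hc2] at hc
      exact (smul_right_injective V (hg.neg hy hyz).ne hc).symm
  have hT : T.Nonempty := by
    have h1 := hf.smul (inv_pos.2 hNf)
    have h2 : N ((N f)⁻¹ • f) = 1 := by simp [hNf.ne']
    refine ⟨(N f)⁻¹ • f, h1, h2, .single ⟨⟨hf, hNf⟩, ⟨h1, by rw [h2]; exact one_pos⟩, ?_⟩⟩
    exact sharesRidge_of_zeros hf hd fun s hs => by simp [(mem_zeros.1 hs).2]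
  obtain ⟨g, ⟨hg, hNg, hgen⟩, hmax⟩ :=
    Set.exists_max_image T (fun g => ∑ s ∈ zeros e Y f₀, e s g) hfin hT
  have hle : ∀ s ∈ zeros e Y f₀, e s g ≤ 0 := fun s hs => hg.nonpos s (zeros_subset hs)
  rcases (Finset.sum_nonpos hle).lt_or_eq with hlt | heq
  · obtain ⟨g', hg', hNg', hsh, hgt⟩ := hg.exists_improving hV hY hn hNg hf₀ hNf₀ hlt
    refine absurd (hmax g' ⟨hg', hNg', hgen.tail ⟨⟨hg, ?_⟩, ⟨hg', ?_⟩, hsh⟩⟩) hgt.not_ge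
    · rw [hNg]; exact one_pos
    · rw [hNg']; exact one_pos
  · rw [Finset.sum_eq_zero_iff_of_nonpos hle] at heq
    refine hgen.tail ⟨⟨hg, by rw [hNg]; exact one_pos⟩, ⟨hf', hNf'⟩, ?_⟩
    rw [hf₀def, zeros_smul (inv_pos.2 hNf').ne'] at heq
    obtain ⟨J, hJ, hc, h1, h2⟩ := sharesRidge_of_zeros hf' hd heq
    exact ⟨J, hJ, hc, h2, h1⟩

theorem Uniform.exists_facetFun_of_ne_zero [FiniteDimensional ℝ V] (hV : finrank ℝ V = d + 1)
    (hY : Uniform e d Y) (hn : d < Y.card) (hf : ∀ y ∈ Y, e y f ≤ 0) (h0 : f ≠ 0) :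
    ∃ g, IsFacetFun e d Y g ∧ zeros e Y f ⊆ zeros e Y g := by
  obtain ⟨g, hg, -, hz⟩ := hY.exists_facetFun hV hn (N := -∑ y ∈ Y, e y) hf (by
    simpa using Uniform.sum_neg hY hn hf h0)
  exact ⟨g, hg, hz⟩

/-- Rotating a facet about one of its ridges, up to the next point, cuts off exactly the remaining
point `z` of the facet. -/
theorem IsFacetFun.exists_swap [DecidableEq α] [FiniteDimensional ℝ V] (hV : finrank ℝ V = d + 1)
    (hY : Uniform e d Y) (hn : d < Y.card) (hf : IsFacetFun e d Y f) {z : α}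
    (hz : z ∈ zeros e Y f) :
    ∃ g, IsFacetFun e d (Y.erase z) g ∧ e z g = 1 ∧ ∀ s ∈ zeros e Y f, s ≠ z → e s g = 0 := by
  obtain ⟨h, h1, h2⟩ := hY.exists_dual hV hn zeros_subset hf.card_zeros hz 1
  obtain ⟨t, ⟨x, hx, hxz, hx0⟩, ht⟩ := exists_pivot (hf.sdiff_nonempty hn)
    (fun y hy hyz => hf.neg hy hyz) h
  have hz1 : e z (h + t • f) = 1 := by simp [h1, (mem_zeros.1 hz).2]
  have hs0 : ∀ s ∈ zeros e Y f, s ≠ z → e s (h + t • f) = 0 := fun s hs hsz => by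
    simp [h2 s hs hsz, (mem_zeros.1 hs).2]
  refine ⟨h + t • f, ⟨fun y hy => ?_, le_antisymm ?_ ?_⟩, hz1, hs0⟩
  · obtain ⟨hyz, hy⟩ := Finset.mem_erase.1 hy
    by_cases hyf : y ∈ zeros e Y f
    · exact (hs0 y hyf hyz).le
    · exact ht y hy hyf
  · refine (hY.mono (Finset.erase_subset _ _)).card_zeros_le fun h0 => ?_
    simp [h0] at hz1
  · have hxz' : x ≠ z := fun h => hxz (h ▸ hz)
    have hsub : insert x ((zeros e Y f).erase z) ⊆ zeros e (Y.erase z) (h + t • f) := by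
      refine Finset.insert_subset (mem_zeros.2 ⟨Finset.mem_erase.2 ⟨hxz', hx⟩, hx0⟩) fun s hs => ?_
      obtain ⟨hsz, hs⟩ := Finset.mem_erase.1 hs
      exact mem_zeros.2 ⟨Finset.mem_erase.2 ⟨hsz, zeros_subset hs⟩, hs0 s hs hsz⟩
    have := Finset.card_le_card hsub
    rwa [Finset.card_insert_of_notMem fun h => hxz (Finset.mem_of_mem_erase h),
      Finset.card_erase_add_one hz, hf.card_zeros] at this

end Arrangement

/-! ### Affine functions and halfspaces -/

section Geometry

open Module

variable {d : ℕ}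

/-- Evaluation at `y` of the affine function `z ↦ ⟪u, z⟫ - c`, as a linear functional of the pair
`(u, c)`. Affine functions on `ℝ^d` are encoded by such pairs throughout. -/
noncomputable def ev (y : Pt d) : Pt d × ℝ →ₗ[ℝ] ℝ :=
  (innerₗ (Pt d) y).comp (LinearMap.fst ℝ _ _) - LinearMap.snd ℝ _ _

/-- The halfspace on which the affine function `f` is nonpositive. -/
def hs (f : Pt d × ℝ) : Set (Pt d) := {z | inner ℝ f.1 z ≤ f.2}

variable {X Y S : Finset (Pt d)} {f g : Pt d × ℝ} {k : ℕ} {H : Set (Pt d)}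

theorem ev_apply (y : Pt d) (f : Pt d × ℝ) : ev y f = inner ℝ f.1 y - f.2 := by
  simp [ev, real_inner_comm]

theorem finrank_affineFun : finrank ℝ (Pt d × ℝ) = d + 1 := by simp

theorem mem_hs {z : Pt d} : z ∈ hs f ↔ ev z f ≤ 0 := by simp [hs, ev_apply]

theorem notMem_hs {z : Pt d} : z ∉ hs f ↔ 0 < ev z f := by rw [mem_hs, not_le]

theorem ev_sum {w : Pt d → ℝ} (hw : ∑ s ∈ S, w s = 1) (f : Pt d × ℝ) :
    ev (∑ s ∈ S, w s • s) f = ∑ s ∈ S, w s * ev s f := by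
  simp only [ev_apply, inner_sum, inner_smul_right, mul_sub, Finset.sum_sub_distrib,
    ← Finset.sum_mul, hw, one_mul]

theorem ev_add_smul {a b : ℝ} (hab : a + b = 1) (x y : Pt d) (f : Pt d × ℝ) :
    ev (a • x + b • y) f = a * ev x f + b * ev y f := by
  simp only [ev_apply, inner_add_right, inner_smul_right]
  linear_combination f.2 * hab

theorem convex_ev_lt (f : Pt d × ℝ) : Convex ℝ {z | ev z f < 0} := by
  intro x hx y hy a b ha hb hab
  simp only [Set.mem_ofPred_eq] at *
  rw [ev_add_smul hab]
  rcases ha.eq_or_lt with rfl | ha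
  · have : b = 1 := by linarith
    simpa [this] using hy
  · nlinarith [mul_nonpos_of_nonneg_of_nonpos hb hy.le]

theorem convex_hs (f : Pt d × ℝ) : Convex ℝ (hs f) := by
  intro x hx y hy a b ha hb hab
  rw [mem_hs] at *
  rw [ev_add_smul hab]
  nlinarith

theorem convexHull_subset_hs {A : Set (Pt d)} (hf : ∀ y ∈ A, ev y f ≤ 0) :
    convexHull ℝ A ⊆ hs f :=
  convexHull_min (fun y hy => mem_hs.2 (hf y hy)) (convex_hs f)

theorem GeneralPosition.mono (hX : GeneralPosition X) (h : Y ⊆ X) : GeneralPosition Y :=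
  fun S hS => hX S (hS.trans h)

theorem fst_ne_zero (hf : f ≠ 0) {y : Pt d} (hy : ev y f = 0) : f.1 ≠ 0 := by
  intro h
  rw [ev_apply, h, inner_zero_left, zero_sub, neg_eq_zero] at hy
  exact hf (Prod.ext h hy)

theorem GeneralPosition.uniform (hX : GeneralPosition X) : Uniform ev d X := by
  intro S hS hc f hf
  by_contra h0
  obtain ⟨s, hs⟩ : S.Nonempty := Finset.card_pos.1 (by omega)
  refine hX S hS hc ⟨f.1, f.2, fst_ne_zero h0 (hf s hs), fun y hy => ?_⟩
  have := hf y hy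
  rw [ev_apply] at this
  linarith

theorem frontier_hs (hf : f.1 ≠ 0) : frontier (hs f) = {z | ev z f = 0} := by
  have hsurj : Function.Surjective (innerSL ℝ f.1) := by
    refine LinearMap.surjective (f := (innerSL ℝ f.1 : Pt d →ₗ[ℝ] ℝ)) fun h => hf ?_
    have := LinearMap.congr_fun h f.1
    simpa using this
  have : hs f = innerSL ℝ f.1 ⁻¹' Set.Iic f.2 := by ext; simp [hs]
  rw [this, ContinuousLinearMap.frontier_preimage _ hsurj, frontier_Iic]
  ext z
  simp [ev_apply, sub_eq_zero]

theorem IsFacetFun.fst_ne_zero (hf : IsFacetFun ev d Y f) (hd : 1 ≤ d) (hn : d < Y.card) :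
    f.1 ≠ 0 := by
  obtain ⟨s, hs⟩ : (zeros ev Y f).Nonempty := Finset.card_pos.1 (by rw [hf.card_zeros]; omega)
  exact TukeyDepth.fst_ne_zero (hf.ne_zero hn) (mem_zeros.1 hs).2

theorem GeneralPosition.vectorSpan_eq_top (hX : GeneralPosition X) (hS : S ⊆ X)
    (hc : S.card = d + 1) : vectorSpan ℝ (S : Set (Pt d)) = ⊤ := by
  by_contra hne
  have hne' : (vectorSpan ℝ (S : Set (Pt d)))ᗮ ≠ ⊥ := fun h =>
    hne (Submodule.orthogonal_eq_bot_iff.1 h)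
  obtain ⟨u, hu, hu0⟩ := Submodule.exists_mem_ne_zero_of_ne_bot hne'
  obtain ⟨s, hs⟩ : S.Nonempty := Finset.card_pos.1 (by omega)
  refine hX S hS hc ⟨u, inner ℝ u s, hu0, fun y hy => ?_⟩
  have := (Submodule.mem_orthogonal' _ _).1 hu _ (vsub_mem_vectorSpan ℝ hy hs)
  rw [vsub_eq_sub, inner_sub_right] at this
  linarith

theorem GeneralPosition.affineIndependent (hX : GeneralPosition X) (hn : d < X.card) (hS : S ⊆ X)
    (hc : S.card ≤ d + 1) : AffineIndependent ℝ ((↑) : S → Pt d) := by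
  obtain ⟨T, hST, hTX, hT⟩ := Finset.exists_subsuperset_card_eq hS hc hn
  have : AffineIndependent ℝ ((↑) : T → Pt d) := by
    rw [affineIndependent_iff_finrank_vectorSpan_eq (n := d) _ _ (by simpa using hT)]
    have h := hX.vectorSpan_eq_top hTX hT
    have hr : Set.range ((↑) : T → Pt d) = (T : Set (Pt d)) := Subtype.range_coe
    rw [hr, h, finrank_top, finrank_euclideanSpace_fin]
  exact AffineIndependent.mono (t := (T : Set (Pt d))) this (Finset.coe_subset.2 hST)

theorem GeneralPosition.finrank_vectorSpan (hX : GeneralPosition X) (hn : d < X.card)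
    (hS : S ⊆ X) (hc : S.card = d) (hd : 1 ≤ d) :
    finrank ℝ (vectorSpan ℝ (S : Set (Pt d))) + 1 = d := by
  have h := (hX.affineIndependent hn hS (by omega)).finrank_vectorSpan (n := d - 1)
    (by simp only [Fintype.card_coe]; omega)
  have hr : Set.range ((↑) : S → Pt d) = (S : Set (Pt d)) := Subtype.range_coe
  rw [hr] at h
  omega

theorem GeneralPosition.affineSpan_eq (hX : GeneralPosition X) (hn : d < X.card) (hd : 1 ≤ d)
    (hS : S ⊆ X) (hc : S.card = d) (hf : f.1 ≠ 0) (h0 : ∀ s ∈ S, ev s f = 0) :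
    (affineSpan ℝ (S : Set (Pt d)) : Set (Pt d)) = {z | ev z f = 0} := by
  obtain ⟨s, hs⟩ : S.Nonempty := Finset.card_pos.1 (by omega)
  have hev : ∀ x y : Pt d, ev x f = 0 → ev y f = 0 → inner ℝ f.1 (x - y) = 0 := by
    intro x y hx hy
    rw [ev_apply] at hx hy
    rw [inner_sub_right]
    linarith
  have hle : vectorSpan ℝ (S : Set (Pt d)) ≤ (ℝ ∙ f.1)ᗮ := by
    rw [vectorSpan_def, Submodule.span_le]
    rintro _ ⟨x, hx, y, hy, rfl⟩
    exact Submodule.mem_orthogonal_singleton_iff_inner_right.2 (hev x y (h0 x hx) (h0 y hy))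
  have heq : vectorSpan ℝ (S : Set (Pt d)) = (ℝ ∙ f.1)ᗮ := by
    refine Submodule.eq_of_le_of_finrank_eq hle ?_
    have h1 := Submodule.finrank_add_finrank_orthogonal (ℝ ∙ f.1)
    rw [finrank_span_singleton hf, finrank_euclideanSpace_fin] at h1
    have h2 := hX.finrank_vectorSpan hn hS hc hd
    omega
  have hmem : ∀ z, z ∈ affineSpan ℝ (S : Set (Pt d)) ↔ inner ℝ f.1 (z - s) = 0 := by
    intro z
    rw [← AffineSubspace.vsub_right_mem_direction_iff_mem (mem_affineSpan ℝ hs) z,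
      direction_affineSpan, heq, Submodule.mem_orthogonal_singleton_iff_inner_right, vsub_eq_sub]
  ext z
  rw [SetLike.mem_coe, hmem, Set.mem_ofPred_eq]
  refine ⟨fun h => ?_, fun h => hev z s h (h0 s hs)⟩
  have h1 := h0 s hs
  rw [ev_apply] at h1 ⊢
  rw [inner_sub_right] at h
  linarith

open Classical in
/-- The points of `X` at which the affine function `f` is positive. -/
noncomputable def positives (X : Finset (Pt d)) (f : Pt d × ℝ) : Finset (Pt d) :=
  {y ∈ X | 0 < ev y f}

theorem cutOff_hs : cutOff X (hs f) = positives X f := by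
  ext y
  simp [cutOff, positives, notMem_hs]

theorem mem_relevant_iff (hd : 1 ≤ d) (hn : d < X.card) (hX : GeneralPosition X) :
    H ∈ relevant X k ↔ ∃ f : Pt d × ℝ, f.1 ≠ 0 ∧ H = hs f ∧ (zeros ev X f).card = d ∧
      (positives X f).card + 1 = k := by
  constructor
  · rintro ⟨⟨⟨u, c, hu, rfl⟩, S, hS, hc, hfr⟩, hk⟩
    have hne : ((u, c) : Pt d × ℝ) ≠ 0 := fun h => hu (congrArg Prod.fst h)
    change frontier (hs (u, c)) = _ at hfr
    rw [frontier_hs (f := (u, c)) hu] at hfr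
    refine ⟨(u, c), hu, rfl, ?_, ?_⟩
    · rw [hX.uniform.zeros_eq hne hS hc fun s hs => ?_, hc]
      have : s ∈ {z | ev z ((u, c) : Pt d × ℝ) = 0} := hfr ▸ mem_affineSpan ℝ hs
      exact this
    · change (cutOff X (hs (u, c))).ncard + 1 = k at hk
      rwa [cutOff_hs, Set.ncard_coe_finset] at hk
  · rintro ⟨f, hf, rfl, hz, hp⟩
    refine ⟨⟨⟨f.1, f.2, hf, rfl⟩, zeros ev X f, zeros_subset, hz, ?_⟩, ?_⟩
    · rw [frontier_hs hf, hX.affineSpan_eq hn hd zeros_subset hz hf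
        fun s hs => (mem_zeros.1 hs).2]
    · rwa [cutOff_hs, Set.ncard_coe_finset]

theorem mem_relevant_one_iff (hd : 1 ≤ d) (hn : d < X.card) (hX : GeneralPosition X) :
    H ∈ relevant X 1 ↔ ∃ f : Pt d × ℝ, IsFacetFun ev d X f ∧ H = hs f := by
  rw [mem_relevant_iff hd hn hX]
  constructor
  · rintro ⟨f, -, rfl, hz, hp⟩
    refine ⟨f, ⟨fun y hy => ?_, hz⟩, rfl⟩
    have : positives X f = ∅ := Finset.card_eq_zero.1 (by omega)
    by_contra! hlt
    have : y ∈ positives X f := by simp [positives, hy, hlt]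
    simp_all
  · rintro ⟨f, hf, rfl⟩
    refine ⟨f, hf.fst_ne_zero hd hn, rfl, hf.card_zeros, ?_⟩
    have : positives X f = ∅ := Finset.filter_eq_empty_iff.2 fun y hy => not_lt.2 (hf.nonpos y hy)
    simp [this]

theorem hs_mem_relevant_two (hd : 1 ≤ d) (hn : d + 1 < X.card) (hX : GeneralPosition X)
    {x : Pt d} (hx : x ∈ X) (hf : IsFacetFun ev d (X.erase x) f) (hxf : 0 < ev x f) :
    hs f ∈ relevant X 2 := by
  have hn' : d < (X.erase x).card := by rw [Finset.card_erase_of_mem hx]; omega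
  rw [mem_relevant_iff hd (by omega) hX]
  refine ⟨f, hf.fst_ne_zero hd hn', rfl, ?_, ?_⟩
  · have : zeros ev X f = zeros ev (X.erase x) f := by
      ext y
      simp only [mem_zeros, Finset.mem_erase]
      refine ⟨fun h => ⟨⟨?_, h.1⟩, h.2⟩, fun h => ⟨h.1.2, h.2⟩⟩
      rintro rfl
      exact hxf.ne' h.2
    rw [this, hf.card_zeros]
  · have : positives X f = {x} := by
      ext y
      simp only [positives, Finset.mem_filter, Finset.mem_singleton]
      refine ⟨fun h => ?_, fun h => h ▸ ⟨hx, hxf⟩⟩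
      by_contra hyx
      exact (hf.nonpos y (Finset.mem_erase.2 ⟨hyx, h.1⟩)).not_gt h.2
    simp [this]

theorem exists_of_mem_relevant_two (hd : 1 ≤ d) (hn : d + 1 < X.card) (hX : GeneralPosition X)
    (hH : H ∈ relevant X 2) {x : Pt d} (hx : x ∈ cutOff X H) :
    ∃ f : Pt d × ℝ, H = hs f ∧ IsFacetFun ev d (X.erase x) f ∧ 0 < ev x f := by
  obtain ⟨f, hf, rfl, hz, hp⟩ := (mem_relevant_iff hd (by omega) hX).1 hH
  rw [cutOff_hs, Finset.mem_coe] at hx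
  obtain ⟨y, hy⟩ := Finset.card_eq_one.1 (show (positives X f).card = 1 by omega)
  obtain rfl : x = y := by simpa [hy] using hx
  have hxf : 0 < ev x f := (Finset.mem_filter.1 hx).2
  refine ⟨f, rfl, ⟨fun y hyX => ?_, ?_⟩, hxf⟩
  · obtain ⟨hyx, hyX⟩ := Finset.mem_erase.1 hyX
    by_contra! hlt
    have : y ∈ positives X f := Finset.mem_filter.2 ⟨hyX, hlt⟩
    rw [hy] at this
    exact hyx (Finset.mem_singleton.1 this)
  · have : zeros ev (X.erase x) f = zeros ev X f := by
      ext y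
      simp only [mem_zeros, Finset.mem_erase]
      refine ⟨fun h => ⟨h.1.2, h.2⟩, fun h => ⟨⟨?_, h.1⟩, h.2⟩⟩
      rintro rfl
      exact hxf.ne' h.2
    rw [this, hz]

theorem SharesRidge.neighbouring {f' : Pt d × ℝ} (h : SharesRidge ev d X f f')
    (hf : f.1 ≠ 0) (hf' : f'.1 ≠ 0) (hm : hs f ∈ relevant X k) (hm' : hs f' ∈ relevant X k) :
    Neighbouring X k (hs f) (hs f') := by
  obtain ⟨J, hJ, hc, h1, h2⟩ := h
  refine ⟨hm, hm', J, ⟨hJ, hc⟩, ?_, ?_⟩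
  · rw [frontier_hs hf]; exact h1
  · rw [frontier_hs hf']; exact h2

/-! ### Faces of the convex hull -/

theorem isClosed_hull : IsClosed (hull X) := X.finite_toSet.isClosed_convexHull ℝ

theorem isExtreme_hull_inter (hf : ∀ y ∈ X, ev y f ≤ 0) :
    IsExtreme ℝ (hull X) (hull X ∩ {z | ev z f = 0}) := by
  have hle : ∀ z ∈ hull X, ev z f ≤ 0 := fun z hz => mem_hs.1 (convexHull_subset_hs hf hz)
  refine ⟨Set.inter_subset_left, fun x hx y hy z hz hzxy => ⟨hx, ?_⟩⟩
  obtain ⟨a, b, ha, hb, hab, rfl⟩ := hzxy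
  have h0 : ev (a • x + b • y) f = 0 := hz.2
  rw [ev_add_smul hab] at h0
  have h1 := hle x hx
  have h2 := mul_nonpos_of_nonneg_of_nonpos hb.le (hle y hy)
  refine le_antisymm h1 ?_
  by_contra! hlt
  nlinarith

/-- A face of `conv X` is the convex hull of the points of `X` on it. -/
theorem subset_convexHull_of_isExtreme {F : Set (Pt d)} (hF : IsExtreme ℝ (hull X) F) :
    F ⊆ convexHull ℝ ((X : Set (Pt d)) ∩ F) := by
  intro z hz
  have hconv : Convex ℝ (hull X \ F) := hF.convex_sdiff (convex_convexHull ℝ _)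
  have hoff : convexHull ℝ ((X : Set (Pt d)) \ F) ⊆ hull X \ F :=
    convexHull_min (Set.sdiff_subset_sdiff_left (subset_convexHull ℝ _)) hconv
  have hzX : z ∈ convexHull ℝ (((X : Set (Pt d)) ∩ F) ∪ ((X : Set (Pt d)) \ F)) := by
    rw [Set.inter_union_sdiff]; exact hF.subset hz
  rcases ((X : Set (Pt d)) ∩ F).eq_empty_or_nonempty with he | hne
  · rw [he, Set.empty_union] at hzX
    exact absurd hz (hoff hzX).2
  rcases ((X : Set (Pt d)) \ F).eq_empty_or_nonempty with he' | hne'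
  · rwa [he', Set.union_empty] at hzX
  rw [convexHull_union hne hne', mem_convexJoin] at hzX
  obtain ⟨a, ha, b, hb, hzab⟩ := hzX
  rw [← insert_endpoints_openSegment] at hzab
  rcases hzab with rfl | rfl | hzab
  · exact ha
  · exact absurd hz (hoff hb).2
  · exact absurd (hF.right_mem_of_mem_openSegment
      (convexHull_mono Set.inter_subset_left ha) (hoff hb).1 hz hzab) (hoff hb).2

theorem hull_inter_eq (hf : ∀ y ∈ X, ev y f ≤ 0) :
    hull X ∩ {z | ev z f = 0} = convexHull ℝ (zeros ev X f : Set (Pt d)) := by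
  refine Set.Subset.antisymm ?_ (Set.subset_inter ?_ ?_)
  · refine (subset_convexHull_of_isExtreme (isExtreme_hull_inter hf)).trans (convexHull_mono ?_)
    rintro y ⟨hy, -, hy0⟩
    exact mem_zeros.2 ⟨hy, hy0⟩
  · exact convexHull_mono (Finset.coe_subset.2 zeros_subset)
  · intro z hz
    have h1 := convexHull_subset_hs (f := f) (fun y hy => (mem_zeros.1 hy).2.le) hz
    have h2 := convexHull_subset_hs (f := -f)
      (fun y hy => by simp [(mem_zeros.1 (Finset.mem_coe.1 hy)).2]) hz
    rw [mem_hs] at h1 h2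
    rw [map_neg] at h2
    exact le_antisymm h1 (by linarith)

/-- A face that meets the interior of `C` is all of `C`. -/
theorem subset_of_isExtreme_of_mem_interior {C F : Set (Pt d)} (hF : IsExtreme ℝ C F)
    {q : Pt d} (hq : q ∈ F) (hqi : q ∈ interior C) : C ⊆ F := by
  intro a ha
  -- The ray from `a` through `q` can be prolonged beyond `q` inside `C`.
  have hcont : ContinuousAt (fun t : ℝ => q + t • (q - a)) 0 := by fun_prop
  have h0 : ∀ᶠ t in nhds (0 : ℝ), q + t • (q - a) ∈ C :=
    hcont.eventually_mem (by simpa using mem_interior_iff_mem_nhds.1 hqi)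
  have hpos : ∀ᶠ t in nhdsWithin (0 : ℝ) (Set.Ioi 0), 0 < t := self_mem_nhdsWithin
  obtain ⟨t, htC, ht⟩ := ((h0.filter_mono nhdsWithin_le_nhds).and hpos).exists
  refine hF.left_mem_of_mem_openSegment ha htC hq ⟨t / (1 + t), 1 / (1 + t), by positivity,
    by positivity, by field_simp; ring, ?_⟩
  rw [smul_add, smul_smul, smul_sub, show (1 / (1 + t)) * t = t / (1 + t) by ring,
    show t / (1 + t) = 1 - 1 / (1 + t) by field_simp; ring]
  module

theorem GeneralPosition.interior_hull_nonempty (hX : GeneralPosition X) (hn : d < X.card) :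
    (interior (hull X)).Nonempty := by
  rw [hull, interior_convexHull_nonempty_iff_affineSpan_eq_top]
  obtain ⟨S, hS, hc⟩ := Finset.exists_subset_card_eq (Nat.succ_le_of_lt hn)
  have hne : (S : Set (Pt d)).Nonempty := Finset.coe_nonempty.2 (Finset.card_pos.1 (by omega))
  refine top_unique (le_trans ?_ (affineSpan_mono ℝ (Finset.coe_subset.2 hS)))
  rw [(AffineSubspace.affineSpan_eq_top_iff_vectorSpan_eq_top_of_nonempty ℝ (Pt d) (Pt d) hne).2
    (hX.vectorSpan_eq_top hS hc)]

/-- A simplex on the boundary of `conv X` lies on a supporting hyperplane. -/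
theorem GeneralPosition.exists_supporting (hX : GeneralPosition X) (hn : d < X.card)
    (hS : S ⊆ X) (hfr : convexHull ℝ (S : Set (Pt d)) ⊆ frontier (hull X)) :
    ∃ f : Pt d × ℝ, f ≠ 0 ∧ (∀ y ∈ X, ev y f ≤ 0) ∧ S ⊆ zeros ev X f := by
  rcases S.eq_empty_or_nonempty with rfl | hne
  · refine ⟨(0, 1), by simp, fun y _ => by simp [ev_apply], Finset.empty_subset _⟩
  -- Take a supporting hyperplane at the centroid of `S`.
  have hcard : (0 : ℝ) < S.card := Nat.cast_pos.2 hne.card_pos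
  have hw : ∑ _s ∈ S, (S.card : ℝ)⁻¹ = 1 := by simp [hcard.ne']
  have hq : ∑ s ∈ S, (S.card : ℝ)⁻¹ • s ∈ convexHull ℝ (S : Set (Pt d)) :=
    (convex_convexHull ℝ _).sum_mem (fun _ _ => by positivity) hw
      fun s hs => subset_convexHull ℝ _ hs
  have hqi := (hfr hq).2
  obtain ⟨φ, r, hφ, hle, hge⟩ := geometric_hahn_banach_of_nonempty_interior
    (convex_convexHull ℝ (X : Set (Pt d))) (convex_singleton _)
    (Set.disjoint_singleton_right.2 hqi) (hX.interior_hull_nonempty hn) (Set.singleton_nonempty _)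
  set u := (InnerProductSpace.toDual ℝ (Pt d)).symm φ with hu
  have hin : ∀ z, inner ℝ u z = φ z := fun z => by
    rw [hu, InnerProductSpace.toDual_symm_apply]
  have hu0 : u ≠ 0 := by
    intro h
    exact hφ ((InnerProductSpace.toDual ℝ (Pt d)).symm.map_eq_zero_iff.1 h)
  have hX0 : ∀ y ∈ X, ev y ((u, r) : Pt d × ℝ) ≤ 0 := fun y hy => by
    rw [ev_apply, hin]
    have := hle y (subset_convexHull ℝ _ hy)
    linarith
  refine ⟨(u, r), fun h => hu0 (congrArg Prod.fst h), hX0, fun s hs => mem_zeros.2 ⟨hS hs, ?_⟩⟩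
  have h1 : 0 ≤ ∑ s ∈ S, (S.card : ℝ)⁻¹ * ev s ((u, r) : Pt d × ℝ) := by
    rw [← ev_sum hw, ev_apply, hin]
    have := hge _ (Set.mem_singleton _)
    linarith
  have h2 : ∀ s ∈ S, (S.card : ℝ)⁻¹ * ev s ((u, r) : Pt d × ℝ) ≤ 0 := fun s hs =>
    mul_nonpos_of_nonneg_of_nonpos (by positivity) (hX0 s (hS hs))
  have h3 := (Finset.sum_eq_zero_iff_of_nonpos h2).1 (le_antisymm (Finset.sum_nonpos h2) h1) s hs
  exact (mul_eq_zero.1 h3).resolve_left (by positivity)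

theorem GeneralPosition.exists_facetFun_of_subset_frontier (hX : GeneralPosition X)
    (hn : d < X.card) (hS : S ⊆ X) (hfr : convexHull ℝ (S : Set (Pt d)) ⊆ frontier (hull X)) :
    ∃ f : Pt d × ℝ, IsFacetFun ev d X f ∧ S ⊆ zeros ev X f := by
  obtain ⟨f, h0, hf, hSf⟩ := hX.exists_supporting hn hS hfr
  obtain ⟨g, hg, hz⟩ := hX.uniform.exists_facetFun_of_ne_zero finrank_affineFun hn hf h0
  exact ⟨g, hg, hSf.trans hz⟩

/-- A point outside `conv Y` is separated from it by a facet. -/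
theorem GeneralPosition.exists_facetFun_of_notMem (hY : GeneralPosition Y) (hn : d < Y.card)
    {p : Pt d} (hp : p ∉ hull Y) : ∃ f : Pt d × ℝ, IsFacetFun ev d Y f ∧ 0 < ev p f := by
  obtain ⟨φ, r, hlt, hgt⟩ := geometric_hahn_banach_closed_point
    (convex_convexHull ℝ (Y : Set (Pt d))) isClosed_hull hp
  have hin : ∀ z, inner ℝ ((InnerProductSpace.toDual ℝ (Pt d)).symm φ) z = φ z := fun z =>
    InnerProductSpace.toDual_symm_apply
  obtain ⟨f, hf, hpf, -⟩ := hY.uniform.exists_facetFun finrank_affineFun hn (N := ev p)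
    (f := ((InnerProductSpace.toDual ℝ (Pt d)).symm φ, r))
    (fun y hy => by
      rw [ev_apply, hin]
      have := hlt y (subset_convexHull ℝ _ hy)
      linarith)
    (by rw [ev_apply, hin]; linarith)
  exact ⟨f, hf, hpf⟩

theorem frontier_of_zeros (hn : d < X.card) (hd : 1 ≤ d) (hf : IsFacetFun ev d X f) :
    convexHull ℝ (zeros ev X f : Set (Pt d)) ⊆ frontier (hull X) := by
  rw [← hull_inter_eq hf.nonpos]
  rintro z ⟨hz, hz0⟩
  refine ⟨subset_closure hz, fun hzi => ?_⟩
  have h1 : z ∈ interior (hs f) := interior_mono (convexHull_subset_hs hf.nonpos) hzi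
  have h2 : z ∈ frontier (hs f) := by rw [frontier_hs (hf.fst_ne_zero hd hn)]; exact hz0
  exact h2.2 h1

theorem IsFacetFun.isFacet (hd : 1 ≤ d) (hn : d < X.card) (hX : GeneralPosition X)
    (hf : IsFacetFun ev d X f) :
    IsFacet (hull X) (convexHull ℝ (zeros ev X f : Set (Pt d))) := by
  refine ⟨convex_convexHull ℝ _, ?_, ?_, ?_⟩
  · rw [← hull_inter_eq hf.nonpos]; exact isExtreme_hull_inter hf.nonpos
  · rw [convexHull_nonempty_iff, Finset.coe_nonempty, ← Finset.card_pos, hf.card_zeros]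
    omega
  · rw [← direction_affineSpan, affineSpan_convexHull, direction_affineSpan]
    exact hX.finrank_vectorSpan hn zeros_subset hf.card_zeros hd

theorem IsFacetFun.mem_extremePoints (hn : d < X.card) (hX : GeneralPosition X)
    (hf : IsFacetFun ev d X f) {s : Pt d} (hs : s ∈ zeros ev X f) :
    s ∈ (hull X).extremePoints ℝ := by
  obtain ⟨g, hg, hg1, -⟩ := hf.exists_swap finrank_affineFun hX.uniform hn hs
  -- `g - 1` vanishes at `s` and is negative at all other points of `X`.
  have hev : ∀ y, ev y (g + (0, 1)) = ev y g - 1 := fun y => by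
    rw [map_add, ev_apply y (0, 1)]; simp [sub_eq_add_neg]
  have hneg : ∀ y ∈ X, y ≠ s → ev y g ≤ 0 := fun y hy hys =>
    hg.nonpos y (Finset.mem_erase.2 ⟨hys, hy⟩)
  have hle : ∀ y ∈ X, ev y (g + (0, 1)) ≤ 0 := by
    intro y hy
    rw [hev]
    by_cases hys : y = s
    · rw [hys, hg1]; norm_num
    · linarith [hneg y hy hys]
  have hz : zeros ev X (g + (0, 1)) = {s} := by
    ext y
    rw [mem_zeros, Finset.mem_singleton, hev]
    refine ⟨fun h => ?_, ?_⟩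
    · by_contra hys
      linarith [hneg y h.1 hys, h.2]
    · rintro rfl
      exact ⟨zeros_subset hs, by rw [hg1]; norm_num⟩
  rw [← isExtreme_singleton]
  have := isExtreme_hull_inter hle
  rwa [hull_inter_eq hle, hz, Finset.coe_singleton, convexHull_singleton] at this

/-- The facets of `conv X`, as faces of dimension `d - 1`, are the simplices spanned by the zeros of
facet functions. -/
theorem IsFacet.exists_facetFun (hn : d < X.card) (hX : GeneralPosition X)
    {F : Set (Pt d)} (hF : IsFacet (hull X) F) :
    ∃ f : Pt d × ℝ, IsFacetFun ev d X f ∧ F = convexHull ℝ (zeros ev X f : Set (Pt d)) := by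
  classical
  obtain ⟨hconv, hext, hne, hdim⟩ := hF
  set S : Finset (Pt d) := {y ∈ X | y ∈ F} with hS
  have hSX : S ⊆ X := Finset.filter_subset _ _
  have hFS : F = convexHull ℝ (S : Set (Pt d)) := by
    have hcoe : (S : Set (Pt d)) = (X : Set (Pt d)) ∩ F := by ext; simp [hS]
    rw [hcoe]
    exact (subset_convexHull_of_isExtreme hext).antisymm
      (convexHull_min Set.inter_subset_right hconv)
  have hSne : S.Nonempty := by
    rw [hFS, convexHull_nonempty_iff] at hne
    exact hne
  have hdS : d ≤ S.card := by
    have h1 := finrank_vectorSpan_image_finset_le ℝ (id : Pt d → Pt d) S (n := S.card - 1)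
      (by have := hSne.card_pos; omega)
    rw [Finset.image_id] at h1
    rw [hFS, ← direction_affineSpan, affineSpan_convexHull, direction_affineSpan] at hdim
    have := hSne.card_pos
    omega
  have hfr : convexHull ℝ (S : Set (Pt d)) ⊆ frontier (hull X) := by
    rw [← hFS]
    intro q hq
    refine ⟨subset_closure (hext.subset hq), fun hqi => ?_⟩
    have hsub := subset_of_isExtreme_of_mem_interior hext hq hqi
    obtain ⟨T, hT, hc⟩ := Finset.exists_subset_card_eq (Nat.succ_le_of_lt hn)
    have h1 := vectorSpan_mono ℝ (((Finset.coe_subset.2 hT).trans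
      (subset_convexHull ℝ (X : Set (Pt d)))).trans hsub)
    rw [hX.vectorSpan_eq_top hT hc, top_le_iff] at h1
    rw [h1, finrank_top, finrank_euclideanSpace_fin] at hdim
    omega
  obtain ⟨f, hf, hSf⟩ := hX.exists_facetFun_of_subset_frontier hn hSX hfr
  refine ⟨f, hf, ?_⟩
  rw [hFS, Finset.eq_of_subset_of_card_le hSf (by rwa [hf.card_zeros])]

end Geometry

/-! ### Orbits of relevant halfspaces -/

section Search

open Module

variable {d : ℕ} {X I J S : Finset (Pt d)} {f g : Pt d × ℝ} {k : ℕ} {H H' G : Set (Pt d)}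

theorem neighbouring_self (hd : 1 ≤ d) (hn : d < X.card) (hX : GeneralPosition X)
    (hH : H ∈ relevant X k) : Neighbouring X k H H := by
  obtain ⟨f, hf, rfl, hz, -⟩ := (mem_relevant_iff hd hn hX).1 hH
  obtain ⟨J, hJ, hc⟩ := Finset.exists_subset_card_eq (show d - 1 ≤ (zeros ev X f).card by omega)
  have : (J : Set (Pt d)) ⊆ frontier (hs f) := by
    rw [frontier_hs hf]; exact fun s hs => (mem_zeros.1 (hJ hs)).2
  exact ⟨hH, hH, J, ⟨hJ.trans zeros_subset, by omega⟩, this, this⟩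

theorem Reachable.right_mem (h : Reachable X k H H') : H' ∈ relevant X k := by
  rcases Relation.TransGen.tail'_iff.1 h with ⟨_, -, h⟩
  exact h.2.1

theorem neg_sum_ev_pos (hn : d < X.card) (hX : GeneralPosition X) (hf : IsFacetFun ev d X f) :
    0 < (-∑ y ∈ X, ev y) f := by
  simpa using hX.uniform.sum_neg hn hf.nonpos (hf.ne_zero hn)

/-- Any two facets of `conv X` are joined by a path of facets, consecutive ones sharing a ridge. -/
theorem IsFacetFun.facet_path (hd : 1 ≤ d) (hn : d < X.card) (hX : GeneralPosition X)
    (hf : IsFacetFun ev d X f) (hg : IsFacetFun ev d X g) :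
    Relation.ReflTransGen (FacetAdj ev d X (-∑ y ∈ X, ev y)) f g :=
  hf.reflTransGen finrank_affineFun hd hX.uniform hn (neg_sum_ev_pos hn hX hf) hg
    (neg_sum_ev_pos hn hX hg)

theorem reachable_one (hd : 1 ≤ d) (hn : d < X.card) (hX : GeneralPosition X)
    (hH : H ∈ relevant X 1) (hH' : H' ∈ relevant X 1) : Reachable X 1 H H' := by
  obtain ⟨f, hf, rfl⟩ := (mem_relevant_one_iff hd hn hX).1 hH
  obtain ⟨g, hg, rfl⟩ := (mem_relevant_one_iff hd hn hX).1 hH'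
  refine Relation.TransGen.tail' ((hf.facet_path hd hn hX hg).lift hs ?_)
    (neighbouring_self hd hn hX hH')
  rintro a b ⟨⟨ha, -⟩, ⟨hb, -⟩, hab⟩
  exact hab.neighbouring (ha.fst_ne_zero hd hn) (hb.fst_ne_zero hd hn)
    ((mem_relevant_one_iff hd hn hX).2 ⟨a, ha, rfl⟩)
    ((mem_relevant_one_iff hd hn hX).2 ⟨b, hb, rfl⟩)

/-- The halfspaces at level two that cut off `x` are the facets of `conv (X \ {x})` visible from
`x`. They are connected, since the simplex method with `f x = 1` as normalization stays among
them. -/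
theorem reachable_two (hd : 1 ≤ d) (hn : d + 1 < X.card) (hX : GeneralPosition X)
    (hH : H ∈ relevant X 2) (hH' : H' ∈ relevant X 2) {x : Pt d} (hx : x ∈ cutOff X H)
    (hx' : x ∈ cutOff X H') : Reachable X 2 H H' := by
  have hxX : x ∈ X := hx.1
  have hn' : d < (X.erase x).card := by rw [Finset.card_erase_of_mem hxX]; omega
  obtain ⟨f, rfl, hf, hxf⟩ := exists_of_mem_relevant_two hd hn hX hH hx
  obtain ⟨g, rfl, hg, hxg⟩ := exists_of_mem_relevant_two hd hn hX hH' hx'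
  have hpath := hf.reflTransGen finrank_affineFun hd
    (hX.uniform.mono (Finset.erase_subset x X)) hn' hxf hg hxg
  refine Relation.TransGen.tail' (hpath.lift hs ?_) (neighbouring_self hd (by omega) hX hH')
  rintro a b ⟨⟨ha, hxa⟩, ⟨hb, hxb⟩, J, hJ, hab⟩
  exact SharesRidge.neighbouring ⟨J, hJ.trans (Finset.erase_subset _ _), hab⟩
    (ha.fst_ne_zero hd hn') (hb.fst_ne_zero hd hn')
    (hs_mem_relevant_two hd hn hX hxX ha hxa) (hs_mem_relevant_two hd hn hX hxX hb hxb)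

theorem exists_facetFun (hn : d < X.card) (hX : GeneralPosition X) :
    ∃ f : Pt d × ℝ, IsFacetFun ev d X f := by
  obtain ⟨f, hf, -⟩ := hX.exists_facetFun_of_subset_frontier hn (Finset.empty_subset X) (by simp)
  exact ⟨f, hf⟩

theorem relevant_one_eq_facetHalfspaces (hd : 1 ≤ d) (hn : d < X.card) (hX : GeneralPosition X) :
    relevant X 1 = facetHalfspaces X := by
  ext H
  rw [mem_relevant_one_iff hd hn hX]
  constructor
  · rintro ⟨f, hf, rfl⟩
    have hf1 := hf.fst_ne_zero hd hn
    refine ⟨⟨f.1, f.2, hf1, rfl⟩, convexHull_subset_hs hf.nonpos, ?_⟩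
    rw [frontier_hs hf1, hull_inter_eq hf.nonpos]
    exact hf.isFacet hd hn hX
  · rintro ⟨⟨u, c, hu, rfl⟩, hsub, hF⟩
    change hull X ⊆ hs (u, c) at hsub
    change IsFacet (hull X) (hull X ∩ frontier (hs (u, c))) at hF
    have hle : ∀ y ∈ X, ev y (u, c) ≤ 0 := fun y hy =>
      mem_hs.1 (hsub (subset_convexHull ℝ _ hy))
    rw [frontier_hs (f := (u, c)) hu, hull_inter_eq hle] at hF
    obtain ⟨g, hg, hgF⟩ := hF.exists_facetFun hn hX
    refine ⟨(u, c), ⟨hle, le_antisymm (hX.uniform.card_zeros_le ?_) ?_⟩, rfl⟩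
    · exact fun h => hu (congrArg Prod.fst h)
    · have h1 : zeros ev X g ⊆ zeros ev X (u, c) := by
        intro y hy
        have : y ∈ hull X ∩ {z | ev z (u, c) = 0} := by
          rw [hull_inter_eq hle, hgF]; exact subset_convexHull ℝ _ hy
        exact mem_zeros.2 ⟨zeros_subset hy, this.2⟩
      exact hg.card_zeros.symm.trans_le (Finset.card_le_card h1)

theorem orbit_one_eq (hd : 1 ≤ d) (hn : d < X.card) (hX : GeneralPosition X)
    (hH : H ∈ relevant X 1) : orbit X 1 H = relevant X 1 :=
  Set.Subset.antisymm (fun _ h => h.right_mem) fun _ h => reachable_one hd hn hX hH h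

/-! ### Vertex-reachability -/

theorem IsFacetFun.vertexNeighbouring (hd : 1 ≤ d) (hn : d < X.card) (hX : GeneralPosition X)
    {f' : Pt d × ℝ} (hf : IsFacetFun ev d X f) (hf' : IsFacetFun ev d X f')
    (hJ : J ⊆ zeros ev X f) (hJ' : J ⊆ zeros ev X f') (hc : J.card + 1 = d) {x x' : Pt d}
    (hx : x ∈ zeros ev X f) (hxJ : x ∉ J) (hx' : x' ∈ zeros ev X f') (hxJ' : x' ∉ J) :
    VertexNeighbouring X x x' := by
  have key : ∀ {h : Pt d × ℝ} {y : Pt d}, IsFacetFun ev d X h → J ⊆ zeros ev X h →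
      y ∈ zeros ev X h → y ∉ J → IsFacet (hull X) (convexHull ℝ (insert y (J : Set (Pt d)))) := by
    intro h y hh hJh hy hyJ
    have : insert y J = zeros ev X h := by
      refine Finset.eq_of_subset_of_card_le (Finset.insert_subset hy hJh) ?_
      rw [Finset.card_insert_of_notMem hyJ, hh.card_zeros, hc]
    rw [← Finset.coe_insert, this]
    exact hh.isFacet hd hn hX
  exact ⟨hf.mem_extremePoints hn hX hx, hf'.mem_extremePoints hn hX hx', J,
    fun s hs => hf.mem_extremePoints hn hX (hJ hs), hc, hxJ, hxJ', key hf hJ hx hxJ,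
    key hf' hJ' hx' hxJ'⟩

theorem exists_facetFun_of_mem_extremePoints (hn : d < X.card) (hd : 1 ≤ d)
    (hX : GeneralPosition X) {v : Pt d} (hv : v ∈ (hull X).extremePoints ℝ) :
    ∃ f : Pt d × ℝ, IsFacetFun ev d X f ∧ v ∈ zeros ev X f := by
  have hvX : v ∈ X := extremePoints_convexHull_subset hv
  obtain ⟨f, hf, hv⟩ := hX.exists_facetFun_of_subset_frontier hn (S := {v}) (by simpa using hvX)
    (by
      rw [Finset.coe_singleton, convexHull_singleton, Set.singleton_subset_iff]
      refine ⟨subset_closure hv.1, fun hvi => ?_⟩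
      have h1 := subset_of_isExtreme_of_mem_interior (isExtreme_singleton.2 hv) rfl hvi
      have h2 : X ⊆ {v} := fun y hy => by
        simpa using h1 (subset_convexHull ℝ _ hy)
      have := Finset.card_le_card h2
      rw [Finset.card_singleton] at this
      omega)
  exact ⟨f, hf, hv (Finset.mem_singleton_self v)⟩

theorem exists_vertexReachable (hd : 1 ≤ d) (hn : d < X.card) (hX : GeneralPosition X)
    {F : Set (Pt d)} (hF : IsFacet (hull X) F) {v : Pt d} (hv : v ∈ (hull X).extremePoints ℝ) :
    ∃ w ∈ F.extremePoints ℝ, VertexReachable X w v := by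
  obtain ⟨f, hf, hFf⟩ := hF.exists_facetFun hn hX
  obtain ⟨g, hg, hvg⟩ := exists_facetFun_of_mem_extremePoints hn hd hX hv
  suffices h : ∃ w ∈ zeros ev X f, VertexReachable X w v by
    obtain ⟨w, hw, hwv⟩ := h
    refine ⟨w, ?_, hwv⟩
    rw [hF.2.1.extremePoints_eq]
    refine ⟨?_, hf.mem_extremePoints hn hX hw⟩
    rw [hFf]
    exact subset_convexHull ℝ _ hw
  -- Induction along a path of facets from `f` to `g`.
  have hpath := hf.facet_path hd hn hX hg
  clear hv
  induction hpath generalizing v with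
  | refl =>
    refine ⟨v, hvg, .single (hf.vertexNeighbouring (J := (zeros ev X f).erase v) hd hn hX hf
      (Finset.erase_subset _ _) (Finset.erase_subset _ _) ?_ hvg (by simp) hvg (by simp))⟩
    rw [Finset.card_erase_add_one hvg, hf.card_zeros]
  | @tail b c _ hbc ih =>
    obtain ⟨⟨hb, -⟩, -, J, hJX, hJ, hJb, hJc⟩ := hbc
    have hJb' : J ⊆ zeros ev X b := fun s hs => mem_zeros.2 ⟨hJX hs, hJb s hs⟩
    have hJc' : J ⊆ zeros ev X c := fun s hs => mem_zeros.2 ⟨hJX hs, hJc s hs⟩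
    by_cases hvJ : v ∈ J
    · exact ih hb (hJb' hvJ)
    · obtain ⟨x, hx, hxJ⟩ := Finset.exists_mem_notMem_of_card_lt_card
        (show J.card < (zeros ev X b).card by rw [hb.card_zeros]; omega)
      obtain ⟨w, hw, hwx⟩ := ih hb hx
      exact ⟨w, hw, hwx.tail (hb.vertexNeighbouring hd hn hX hg hJb' hJc' hJ hx hxJ hvg hvJ)⟩

/-! ### The ridge search -/

theorem exists_isHullRidge (hd : 1 ≤ d) (hn : d < X.card) (hX : GeneralPosition X) :
    ∃ I, IsHullRidge X I := by
  obtain ⟨f, hf⟩ := exists_facetFun hn hX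
  obtain ⟨J, hJ, hc⟩ := hf.exists_ridge hd
  exact ⟨J, ⟨hJ.trans zeros_subset, hc⟩,
    (convexHull_mono (Finset.coe_subset.2 hJ)).trans (frontier_of_zeros hn hd hf)⟩

theorem searchFrom_mono (X : Finset (Pt d)) (k : ℕ) (I : Finset (Pt d)) :
    Monotone (searchFrom X k I) :=
  monotone_nat_of_le_succ fun _ _ h => Or.inl h

theorem ridgeSearchRounds_mono (X : Finset (Pt d)) (k : ℕ) (Q : Set (Finset (Pt d))) :
    Monotone (ridgeSearchRounds X k Q) := fun _ _ hmn _ ⟨I, hI, h⟩ =>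
  ⟨I, hI, searchFrom_mono X k I hmn h⟩

theorem searchFrom_subset (X : Finset (Pt d)) (k : ℕ) (I : Finset (Pt d)) (m : ℕ) :
    searchFrom X k I m ⊆ relevant X k := by
  induction m with
  | zero => exact fun _ h => h.1
  | succ m ih =>
    rintro H (h | ⟨-, -, J, -, -, h⟩)
    · exact ih h
    · exact h.1

theorem algorithmA_subset (X : Finset (Pt d)) (k : ℕ) (I : Finset (Pt d)) :
    algorithmA X k I ⊆ relevant X k := fun _ ⟨m, J, _, h⟩ => searchFrom_subset X k J m h

theorem relevantThrough_subset_algorithmA (hJ : J ∈ queueA X k I) :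
    relevantThrough X k J ⊆ algorithmA X k I := fun _ h => ⟨0, J, hJ, h⟩

theorem Reachable.mem_algorithmA (h : Reachable X k H H') (hH : H ∈ algorithmA X k I) :
    H' ∈ algorithmA X k I := by
  induction h with
  | single h =>
    obtain ⟨m, J, hJ, hm⟩ := hH
    obtain ⟨-, hb, K, hK, h1, h2⟩ := h
    exact ⟨m + 1, J, hJ, Or.inr ⟨_, hm, K, hK, h1, hb, h2⟩⟩
  | tail _ h ih =>
    obtain ⟨m, J, hJ, hm⟩ := ih
    obtain ⟨-, hb, K, hK, h1, h2⟩ := h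
    exact ⟨m + 1, J, hJ, Or.inr ⟨_, hm, K, hK, h1, hb, h2⟩⟩

/-- A relevant halfspace is determined by the points of `X` on its boundary and those it cuts
off. -/
theorem relevant_finite (hd : 1 ≤ d) (hn : d < X.card) (hX : GeneralPosition X) (k : ℕ) :
    (relevant X k).Finite := by
  classical
  have : ∀ H ∈ relevant X k, ∃ f : Pt d × ℝ, H = hs f ∧ (zeros ev X f).card = d := fun H hH => by
    obtain ⟨f, -, h1, h2, -⟩ := (mem_relevant_iff hd hn hX).1 hH
    exact ⟨f, h1, h2⟩
  choose! φ hφ hφc using this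
  refine Set.Finite.of_finite_image (f := fun H => (zeros ev X (φ H), positives X (φ H)))
    ((Finset.finite_toSet (X.powerset ×ˢ X.powerset)).subset ?_) ?_
  · rintro _ ⟨H, -, rfl⟩
    exact Finset.mem_coe.2 (Finset.mem_product.2 ⟨Finset.mem_powerset.2 zeros_subset,
      Finset.mem_powerset.2 (Finset.filter_subset _ _)⟩)
  · intro H hH H' hH' heq
    obtain ⟨hz, hp⟩ := Prod.ext_iff.1 heq
    dsimp only at hz hp
    obtain ⟨y, hy, hyz⟩ := Finset.exists_mem_notMem_of_card_lt_card
      (show (zeros ev X (φ H)).card < X.card by rw [hφc H hH]; exact hn)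
    have h0 : ev y (φ H) ≠ 0 := fun h => hyz (mem_zeros.2 ⟨hy, h⟩)
    have h0' : ev y (φ H') ≠ 0 := fun h => hyz (hz ▸ mem_zeros.2 ⟨hy, h⟩)
    have hsign : 0 < ev y (φ H) ↔ 0 < ev y (φ H') := by
      have h1 : y ∈ positives X (φ H) ↔ y ∈ positives X (φ H') := by rw [hp]
      simpa [positives, hy] using h1
    have hc := hX.uniform.cross_eq (hφc H hH) (g := φ H')
      (fun s hs => (mem_zeros.1 (hz ▸ hs)).2) hy h0
    rw [hφ H hH, hφ H' hH']
    ext z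
    have hcz := congrArg (ev z) hc
    simp only [map_smul, smul_eq_mul] at hcz
    rw [mem_hs, mem_hs]
    rcases lt_or_gt_of_ne h0 with h1 | h1
    · have h2 : ev y (φ H') < 0 := lt_of_le_of_ne (not_lt.1 fun h => (hsign.2 h).not_gt h1) h0'
      constructor <;> intro h <;> by_contra! hlt <;> nlinarith
    · have h2 := hsign.1 h1
      constructor <;> intro h <;> by_contra! hlt <;> nlinarith

theorem exists_rounds (hd : 1 ≤ d) (hn : d < X.card) (hX : GeneralPosition X)
    (h : relevant X k ⊆ algorithmA X k I) :
    ∃ M : ℕ, ∀ m, M ≤ m → ridgeSearchRounds X k (queueA X k I) m = relevant X k := by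
  choose! r hr using h
  obtain ⟨M, hM⟩ := ((relevant_finite hd hn hX k).image r).bddAbove
  refine ⟨M, fun m hm => Set.Subset.antisymm ?_ fun H hH => ?_⟩
  · rintro H ⟨J, -, hJ⟩
    exact searchFrom_subset X k J m hJ
  · exact ridgeSearchRounds_mono X k _ ((hM (Set.mem_image_of_mem r hH)).trans hm) (hr hH)

theorem relevant_one_subset_algorithmA (hd : 1 ≤ d) (hn : d < X.card) (hX : GeneralPosition X)
    (hI : IsHullRidge X I) : relevant X 1 ⊆ algorithmA X 1 I := by
  obtain ⟨f, hf, hIf⟩ := hX.exists_facetFun_of_subset_frontier hn hI.1.1 hI.2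
  have hmem := (mem_relevant_one_iff hd hn hX).2 ⟨f, hf, rfl⟩
  have hthr : hs f ∈ relevantThrough X 1 I := by
    refine ⟨hmem, ?_⟩
    rw [frontier_hs (hf.fst_ne_zero hd hn)]
    exact fun s hs => (mem_zeros.1 (hIf hs)).2
  have hIQ : I ∈ queueA X 1 I := Or.inl ⟨_, hthr, hI.1, hthr.2⟩
  exact fun H hH => (reachable_one hd hn hX hmem hH).mem_algorithmA
    (relevantThrough_subset_algorithmA hIQ hthr)

/-- For every vertex `z` of a facet, some halfspace at level two contains the opposite ridge in its
boundary and cuts off `z`. -/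
theorem IsFacetFun.exists_mem_relevant_two (hd : 1 ≤ d) (hn : d + 1 < X.card)
    (hX : GeneralPosition X) (hf : IsFacetFun ev d X f) {z : Pt d} (hz : z ∈ zeros ev X f) :
    ∃ H ∈ relevant X 2, z ∈ cutOff X H ∧ ∀ s ∈ zeros ev X f, s ≠ z → s ∈ frontier H := by
  obtain ⟨g, hg, hg1, hg0⟩ := hf.exists_swap finrank_affineFun hX.uniform (by omega) hz
  have hzX := zeros_subset hz
  have hn' : d < (X.erase z).card := by rw [Finset.card_erase_of_mem hzX]; omega
  have hpos : 0 < ev z g := by rw [hg1]; exact one_pos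
  refine ⟨hs g, hs_mem_relevant_two hd hn hX hzX hg hpos, ⟨hzX, notMem_hs.2 hpos⟩, ?_⟩
  rw [frontier_hs (hg.fst_ne_zero hd hn')]
  exact hg0

/-- It suffices that the search finds, for every vertex `z` of one facet, a halfspace that cuts off
`z`. Indeed, if `x` and `x'` are the apices of two facets over a common ridge, then some halfspaces
cutting off `x` and `x'` respectively are neighbours through this ridge, so that the search passes
from `x` to `x'`. -/
theorem relevant_two_subset_of_zeros (hd : 1 ≤ d) (hn : d + 1 < X.card) (hX : GeneralPosition X)
    (hf : IsFacetFun ev d X f)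
    (h : ∀ z ∈ zeros ev X f, ∃ H ∈ algorithmA X 2 I, z ∈ cutOff X H) :
    relevant X 2 ⊆ algorithmA X 2 I := by
  have hn' : d < X.card := by omega
  have hall : ∀ {H z}, H ∈ algorithmA X 2 I → z ∈ cutOff X H → ∀ H' ∈ relevant X 2,
      z ∈ cutOff X H' → H' ∈ algorithmA X 2 I := fun hH hz H' hH' hz' =>
    (reachable_two hd hn hX (algorithmA_subset X 2 I hH) hH' hz hz').mem_algorithmA hH
  intro H hH
  obtain ⟨y, hy⟩ : (cutOff X H).Nonempty :=
    Set.nonempty_of_ncard_ne_zero (by have := hH.2; omega)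
  -- The cut-off point lies on a facet, since the halfspace translated to `y` supports `X`.
  obtain ⟨h₀, rfl, hh₀, hyh⟩ := exists_of_mem_relevant_two hd hn hX hH hy
  obtain ⟨g, hg, hyg⟩ : ∃ g, IsFacetFun ev d X g ∧ y ∈ zeros ev X g := by
    have hev : ∀ z, ev z (h₀ + (0, ev y h₀)) = ev z h₀ - ev y h₀ := fun z => by
      rw [map_add, ev_apply z (0, ev y h₀)]; simp [sub_eq_add_neg]
    obtain ⟨g, hg, hsub⟩ := hX.uniform.exists_facetFun_of_ne_zero finrank_affineFun hn'
      (f := h₀ + (0, ev y h₀)) (fun z hz => by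
        rw [hev]
        by_cases hzy : z = y
        · simp [hzy]
        · linarith [hh₀.nonpos z (Finset.mem_erase.2 ⟨hzy, hz⟩)])
      (fun h0 => by
        have hc : d < (X.erase y).card := by rw [Finset.card_erase_of_mem hy.1]; omega
        exact hh₀.fst_ne_zero hd hc (by simpa using congrArg Prod.fst h0))
    exact ⟨g, hg, hsub (mem_zeros.2 ⟨hy.1, by rw [hev, sub_self]⟩)⟩
  suffices hsuff : ∃ H ∈ algorithmA X 2 I, y ∈ cutOff X H by
    obtain ⟨H₁, hH₁, hy₁⟩ := hsuff
    exact hall hH₁ hy₁ _ hH hy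
  have hpath := hf.facet_path hd hn' hX hg
  clear hy hyh hh₀ hH
  induction hpath generalizing y with
  | refl => exact h y hyg
  | @tail b c _ hbc ih =>
    obtain ⟨⟨hb, -⟩, -, J, hJX, hJ, hJb, hJc⟩ := hbc
    have hJb' : J ⊆ zeros ev X b := fun s hs => mem_zeros.2 ⟨hJX hs, hJb s hs⟩
    have hJc' : J ⊆ zeros ev X c := fun s hs => mem_zeros.2 ⟨hJX hs, hJc s hs⟩
    by_cases hyJ : y ∈ J
    · exact ih y hb (hJb' hyJ)
    · obtain ⟨x, hx, hxJ⟩ := Finset.exists_mem_notMem_of_card_lt_card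
        (show J.card < (zeros ev X b).card by rw [hb.card_zeros]; omega)
      obtain ⟨H₁, hH₁, hx₁⟩ := ih x hb hx
      obtain ⟨H₂, hH₂, hx₂, hfr₂⟩ := hb.exists_mem_relevant_two hd hn hX hx
      obtain ⟨H₃, hH₃, hy₃, hfr₃⟩ := hg.exists_mem_relevant_two hd hn hX hyg
      have hnb : Neighbouring X 2 H₂ H₃ := ⟨hH₂, hH₃, J, ⟨hJX, hJ⟩,
        fun s hs => hfr₂ s (hJb' hs) fun h => hxJ (h ▸ hs),
        fun s hs => hfr₃ s (hJc' hs) fun h => hyJ (h ▸ hs)⟩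
      exact ⟨H₃, Reachable.mem_algorithmA (.single hnb) (hall hH₁ hx₁ H₂ hH₂ hx₂), hy₃⟩

theorem relevant_two_subset_algorithmA (hd : 1 ≤ d) (hn : d + 1 < X.card)
    (hX : GeneralPosition X) (hI : IsHullRidge X I) : relevant X 2 ⊆ algorithmA X 2 I := by
  obtain ⟨f, hf, hIf⟩ := hX.exists_facetFun_of_subset_frontier (by omega) hI.1.1 hI.2
  have hIc := hI.1.2
  obtain ⟨z, hz, hzI⟩ := Finset.exists_mem_notMem_of_card_lt_card
    (show I.card < (zeros ev X f).card by rw [hf.card_zeros]; omega)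
  have hins : insert z I = zeros ev X f := by
    refine Finset.eq_of_subset_of_card_le (Finset.insert_subset hz hIf) ?_
    rw [Finset.card_insert_of_notMem hzI, hf.card_zeros, hIc]
  obtain ⟨H, hH, hzH, hfr⟩ := hf.exists_mem_relevant_two hd hn hX hz
  have hthr : H ∈ relevantThrough X 2 I :=
    ⟨hH, fun s hs => hfr s (hIf hs) fun h => hzI (h ▸ hs)⟩
  refine relevant_two_subset_of_zeros hd hn hX hf fun w hw => ?_
  rcases Finset.mem_insert.1 (hins ▸ hw) with rfl | hwI
  · exact ⟨H, relevantThrough_subset_algorithmA (Or.inl ⟨H, hthr, hI.1, hthr.2⟩) hthr, hzH⟩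
  -- Exchanging `w` for the cut-off point `z` gives another ridge of the facet.
  · obtain ⟨H', hH', hwH', hfr'⟩ := hf.exists_mem_relevant_two hd hn hX hw
    have hJ : insert z (I.erase w) ∈ queueA X 2 I := by
      refine Or.inr ⟨H, hthr, z, hzH, I.erase w, Finset.erase_subset _ _, ?_,
        Finset.coe_insert _ _⟩
      have := Finset.card_erase_add_one hwI
      omega
    refine ⟨H', relevantThrough_subset_algorithmA hJ ⟨hH', fun s hs => ?_⟩, hwH'⟩
    rcases Finset.mem_insert.1 (Finset.mem_coe.1 hs) with rfl | hs
    · exact hfr' s hz fun h => hzI (h ▸ hwI)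
    · obtain ⟨hsw, hs⟩ := Finset.mem_erase.1 hs
      exact hfr' s (hIf hs) hsw

/-! ### Depth regions as intersections of halfspaces -/

theorem le_depth_iff (hd : 1 ≤ d) {x : Pt d} :
    k ≤ depth X x ↔ ∀ f : Pt d × ℝ, f.1 ≠ 0 → ev x f = 0 →
      k ≤ {y : Pt d | y ∈ X ∧ 0 ≤ ev y f}.ncard := by
  have : Nonempty (Fin d) := ⟨⟨0, hd⟩⟩
  have hne : Nonempty (Metric.sphere (0 : Pt d) 1) :=
    (NormedSpace.sphere_nonempty.2 zero_le_one).to_subtype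
  constructor
  · intro h f hf hx
    have hpos : 0 < ‖f.1‖ := norm_pos_iff.2 hf
    refine h.trans ((ciInf_le (OrderBot.bddBelow _)
      (⟨‖f.1‖⁻¹ • f.1, by simp [norm_smul, hpos.ne']⟩ : Metric.sphere (0 : Pt d) 1)).trans_eq ?_)
    congr 1
    ext y
    simp only [Set.mem_ofPred_eq, inner_smul_right, ev_apply] at hx ⊢
    rw [mul_le_mul_iff_right₀ (inv_pos.2 hpos), real_inner_comm, real_inner_comm f.1 y]
    refine and_congr_right fun _ => ?_
    constructor <;> intro h <;> linarith
  · intro h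
    refine le_ciInf fun u => ?_
    have hu : (u : Pt d) ≠ 0 := by
      intro h0
      have := u.2
      simp [h0] at this
    refine (h (u, inner ℝ (u : Pt d) x) hu (by simp [ev_apply])).trans_eq ?_
    congr 1
    ext y
    simp only [Set.mem_ofPred_eq, ev_apply, sub_nonneg]
    rw [real_inner_comm, real_inner_comm (u : Pt d) y]

theorem centralRegion_subset (hd : 1 ≤ d) (hn : d < X.card) (hX : GeneralPosition X)
    (hH : H ∈ relevant X k) : centralRegion X k ⊆ H := by
  intro x hx
  obtain ⟨f, hf, rfl, -, hp⟩ := (mem_relevant_iff hd hn hX).1 hH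
  by_contra hxH
  rw [notMem_hs] at hxH
  have hev : ∀ y, ev y (f + (0, ev x f)) = ev y f - ev x f := fun y => by
    rw [map_add, ev_apply y (0, ev x f)]; simp [sub_eq_add_neg]
  have h1 := (le_depth_iff hd).1 hx (f + (0, ev x f)) (by simpa using hf) (by rw [hev, sub_self])
  have h2 : {y : Pt d | y ∈ X ∧ 0 ≤ ev y (f + (0, ev x f))} ⊆ positives X f := by
    rintro y ⟨hy, h0⟩
    rw [hev] at h0
    exact Finset.mem_coe.2 (Finset.mem_filter.2 ⟨hy, by linarith⟩)
  have h3 := Set.ncard_le_ncard h2 (Finset.finite_toSet _)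
  rw [Set.ncard_coe_finset] at h3
  omega

theorem notMem_hull_of_ev_neg {x : Pt d} (hx : 0 ≤ ev x f) (hf : ∀ y ∈ X, ev y f < 0) :
    x ∉ hull X := fun h =>
  hx.not_gt (convexHull_min (fun y hy => hf y hy) (convex_ev_lt f) h)

/-- Every point outside `conv X` violates some halfspace at level two. Otherwise, let `f` be a facet
visible from `p`, and for each vertex `s` of it, let `g s` be the affine function that vanishes on
the opposite ridge, equals one at `s`, and is nonpositive on the other points. The sum of the `g s`
is one on the hyperplane `f = 0`, but nonpositive on both sides of it. -/
theorem exists_relevant_two_of_notMem_hull (hd : 1 ≤ d) (hn : d + 1 < X.card)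
    (hX : GeneralPosition X) {p : Pt d} (hp : p ∉ hull X) : ∃ H ∈ relevant X 2, p ∉ H := by
  have hn' : d < X.card := by omega
  obtain ⟨f, hf, hpf⟩ := hX.exists_facetFun_of_notMem hn' hp
  have hg : ∀ s ∈ zeros ev X f, ∃ g : Pt d × ℝ, IsFacetFun ev d (X.erase s) g ∧ ev s g = 1 ∧
      ∀ t ∈ zeros ev X f, t ≠ s → ev t g = 0 := fun s hs =>
    hf.exists_swap finrank_affineFun hX.uniform hn' hs
  choose! g hgf hg1 hg0 using hg
  by_contra! hall
  have hpg : ∀ s ∈ zeros ev X f, ev p (g s) ≤ 0 := fun s hs => mem_hs.1 <|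
    hall _ <| hs_mem_relevant_two hd hn hX (zeros_subset hs) (hgf s hs) <| by
      rw [hg1 s hs]; exact one_pos
  obtain ⟨y, hy, hyz⟩ := hf.sdiff_nonempty hn'
  have hev : ∀ z, ev z (∑ s ∈ zeros ev X f, g s + (0, 1)) =
      ∑ s ∈ zeros ev X f, ev z (g s) - 1 := fun z => by
    rw [map_add, map_sum, ev_apply z (0, 1)]; simp [sub_eq_add_neg]
  have hc := hX.uniform.cross_eq hf.card_zeros (g := ∑ s ∈ zeros ev X f, g s + (0, 1))
    (fun t ht => by
      rw [hev, Finset.sum_eq_single_of_mem t ht fun s hs hst => hg0 s hs t ht hst.symm, hg1 t ht,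
        sub_self]) hy (hf.neg hy hyz).ne
  have hcp := congrArg (ev p) hc
  rw [map_smul, map_smul, hev, hev, smul_eq_mul, smul_eq_mul] at hcp
  have h1 : ∑ s ∈ zeros ev X f, ev p (g s) ≤ 0 := Finset.sum_nonpos hpg
  have h2 : ∑ s ∈ zeros ev X f, ev y (g s) ≤ 0 := Finset.sum_nonpos fun s hs =>
    (hgf s hs).nonpos y (Finset.mem_erase.2 ⟨fun h => hyz (h ▸ hs), hy⟩)
  nlinarith [hf.neg hy hyz]

theorem sInter_relevant_one (hd : 1 ≤ d) (hn : d < X.card) (hX : GeneralPosition X) :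
    ⋂₀ relevant X 1 = centralRegion X 1 := by
  refine Set.Subset.antisymm (fun x hx => ?_)
    (Set.subset_sInter fun H hH => centralRegion_subset hd hn hX hH)
  by_contra hxc
  have := mt (le_depth_iff hd).2 hxc
  push Not at this
  obtain ⟨f, -, hxf, hlt⟩ := this
  have hfin : {y : Pt d | y ∈ X ∧ 0 ≤ ev y f}.Finite := X.finite_toSet.subset fun y hy => hy.1
  have he := (Set.ncard_eq_zero hfin).1 (by omega)
  have hxX : x ∉ hull X := notMem_hull_of_ev_neg hxf.ge fun y hy => by
    by_contra! h0
    exact (he ▸ (show y ∈ {y : Pt d | y ∈ X ∧ 0 ≤ ev y f} from ⟨hy, h0⟩) : y ∈ (∅ : Set (Pt d)))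
  obtain ⟨g, hg, hxg⟩ := hX.exists_facetFun_of_notMem hn hxX
  exact notMem_hs.2 hxg (hx _ ((mem_relevant_one_iff hd hn hX).2 ⟨g, hg, rfl⟩))

theorem sInter_relevant_two (hd : 1 ≤ d) (hn : d + 1 < X.card) (hX : GeneralPosition X) :
    ⋂₀ relevant X 2 = centralRegion X 2 := by
  refine Set.Subset.antisymm (fun x hx => ?_)
    (Set.subset_sInter fun H hH => centralRegion_subset hd (by omega) hX hH)
  have hxX : x ∈ hull X := by
    by_contra hxX
    obtain ⟨H, hH, hxH⟩ := exists_relevant_two_of_notMem_hull hd hn hX hxX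
    exact hxH (hx H hH)
  by_contra hxc
  have := mt (le_depth_iff hd).2 hxc
  push Not at this
  obtain ⟨f, -, hxf, hlt⟩ := this
  have hfin : {y : Pt d | y ∈ X ∧ 0 ≤ ev y f}.Finite := X.finite_toSet.subset fun y hy => hy.1
  obtain ⟨y₀, hy₀⟩ : {y : Pt d | y ∈ X ∧ 0 ≤ ev y f}.Nonempty := by
    by_contra! he
    refine notMem_hull_of_ev_neg hxf.ge (fun y hy => ?_) hxX
    by_contra! h0
    exact (he ▸ (show y ∈ {y : Pt d | y ∈ X ∧ 0 ≤ ev y f} from ⟨hy, h0⟩) : y ∈ (∅ : Set (Pt d)))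
  have hxE : x ∉ hull (X.erase y₀) := notMem_hull_of_ev_neg hxf.ge fun y hy => by
    obtain ⟨hne, hy⟩ := Finset.mem_erase.1 hy
    by_contra! h0
    exact hne ((Set.ncard_le_one hfin).1 (by omega) y ⟨hy, h0⟩ y₀ hy₀)
  obtain ⟨g, hg, hxg⟩ := (hX.mono (Finset.erase_subset _ _)).exists_facetFun_of_notMem
    (by rw [Finset.card_erase_of_mem hy₀.1]; omega) hxE
  -- The separating facet of `X \ {y₀}` cuts off `y₀`, because `x` lies in `conv X`.
  have hy₀g : 0 < ev y₀ g := by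
    by_contra! hle
    refine notMem_hs.2 hxg (convexHull_subset_hs (fun y hy => ?_) hxX)
    by_cases hyy : y = y₀
    · rw [hyy]; exact hle
    · exact hg.nonpos y (Finset.mem_erase.2 ⟨hyy, hy⟩)
  exact notMem_hs.2 hxg (hx _ (hs_mem_relevant_two hd hn hX hy₀.1 hg hy₀g))

end Search

end TukeyDepth

theorem mainTheorem3 (d : ℕ) (hd : 1 ≤ d) (X : Finset (EuclideanSpace ℝ (Fin d)))
    (hn : d + 1 < X.card) (hX : GeneralPosition X) :
    -- an admissible starting ridge exists, and from every one of them Algorithm (A) is exact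
    (∃ I, IsHullRidge X I) ∧
    (∀ k : ℕ, k = 1 ∨ k = 2 → ∀ I, IsHullRidge X I →
      (∃ M : ℕ, ∀ m, M ≤ m → ridgeSearchRounds X k (queueA X k I) m = relevant X k) ∧
      algorithmA X k I = relevant X k ∧
      ⋂₀ (algorithmA X k I) = centralRegion X k) ∧
    -- level one: the facet halfspaces form a single orbit
    (relevant X 1 = facetHalfspaces X ∧ (relevant X 1).Nonempty ∧
      ∀ H ∈ relevant X 1, orbit X 1 H = relevant X 1) ∧
    -- level two: halfspaces that cut off the same point are reachable from one another
    (∀ H ∈ relevant X 2, ∀ H' ∈ relevant X 2, ∀ x : EuclideanSpace ℝ (Fin d),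
      x ∈ cutOff X H → x ∈ cutOff X H' → Reachable X 2 H H') ∧
    -- every vertex of the hull is vertex-reachable from a vertex of any given facet
    (∀ F, IsFacet (hull X) F → ∀ v ∈ (hull X).extremePoints ℝ,
      ∃ w ∈ F.extremePoints ℝ, VertexReachable X w v) := by
  have hn' : d < X.card := by omega
  refine ⟨exists_isHullRidge hd hn' hX, ?_, ⟨relevant_one_eq_facetHalfspaces hd hn' hX, ?_,
    fun H hH => orbit_one_eq hd hn' hX hH⟩,
    fun H hH H' hH' x hx hx' => reachable_two hd hn hX hH hH' hx hx',
    fun F hF v hv => exists_vertexReachable hd hn' hX hF hv⟩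
  · intro k hk I hI
    have hsub : relevant X k ⊆ algorithmA X k I := by
      rcases hk with rfl | rfl
      · exact relevant_one_subset_algorithmA hd hn' hX hI
      · exact relevant_two_subset_algorithmA hd hn hX hI
    have heq : algorithmA X k I = relevant X k := (algorithmA_subset X k I).antisymm hsub
    refine ⟨exists_rounds hd hn' hX hsub, heq, ?_⟩
    rw [heq]
    rcases hk with rfl | rfl
    · exact sInter_relevant_one hd hn' hX
    · exact sInter_relevant_two hd hn hX
  · obtain ⟨f, hf⟩ := exists_facetFun hn' hX
    exact ⟨hs f, (mem_relevant_one_iff hd hn' hX).2 ⟨f, hf, rfl⟩⟩
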